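/- Let $\mathcal X\subset\mathbb R$ be countable, let $\mathcal X_2=\{(k,l)\in\mathcal X^2: k\ne l\}$ carry a (strict) total order $\prec$, and for each $(k,l)\in\mathcal X_2$ let $\lambda_{kl}:[0,\infty)\to(0,\infty)$ be bounded and measurable. Write $\|\cdot\|_\infty$ for the $L^\infty$ norm on $[0,\infty)$ and $\lambda_k(y)=\sum_{l\ne k}\lambda_{kl}(y)$, and assume (A1) $\sum_{(k,l)\in\mathcal X_2}\|\lambda_{kl}\|_\infty<\infty$; (A2) $\lim_{y\to\infty}\int_0^y\lambda_k(t)\,dt=\infty$ for every $k\in\mathcal X$. Let $\tilde\lambda_{kl}:[0,\infty)\to(0,\infty)$ be measurable functions with $\lambda_{kl}(y)\le\tilde\lambda_{kl}(y)$ for all $y\ge0$, satisfying (A3) for every $(k,l)\in\mathcal X_2$, $\tilde\lambda_{kl}(y)=\|\lambda_{kl}\|_\infty$ for almost every $y\ge 0$. Define the intervals $$\Lambda_{kl}(y)=\Big(\sum_{(k',l')\prec(k,l)}\tilde\lambda_{k'l'}(y)\Big)+[0,\lambda_{kl}(y))\subset\mathbb R$$ (empty if the sum is infinite), and, for $k\in\mathcal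 X$, $y\ge0$, $v\in\mathbb R$, $$h_\Lambda(k,y,v)=\sum_{l\ne k}(l-k)\mathbf 1_{\Lambda_{kl}(y)}(v),\qquad g_\Lambda(k,y,v)=y\sum_{l\ne k}\mathbf 1_{\Lambda_{kl}(y)}(v).$$ Let $\wp$ be a Poisson random measure on $[0,\infty)\times\mathbb R$ with Lebesgue intensity, on a probability space $(\Omega,\mathcal F,P)$. Let $i,j\in\mathcal X$ with $i\neq j$, let $y_1,y_2\ge0$, and let $(X^1,Y^1)$ and $(X^2,Y^2)$ be $\mathcal X\times[0,\infty)$-valued processes, $X^1,X^2$ having pure jump paths (right continuous with left limits for the discrete topology of $\mathcal X$), which almost surely solve, for all $t>0$, $$X_t=X_0+\int_{(0,t]}\int_{\mathbb R}h_\Lambda(X_{u-},Y_{u-},v)\,\wp(du,dv),\qquad Y_t=Y_0+t-\int_{(0,t]}\int_{\mathbb R}g_\Lambda(X_{u-},Y_{u-},v)\,\wp(du,dv)$$ (with absolutely convergent integrals), driven by the same $\wp$, with initial conditions $(X^1_0,Y^1_0)=(i,y_1)$ and $(X^2_0,Y^2_0)=(j,y_2)$ respectively. Let $T_1=\inf\{t>0: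 X^1_{t-}\ne X^1_t\text{ or }X^2_{t-}\ne X^2_t\}$ be the first collective transition time. The event that $X^1$ and $X^2$ meet at the next transition is $$E=\{T_1<\infty,\ X^1_{T_1}=X^2_{T_1},\ \min(Y^1_{T_1},Y^2_{T_1})=0\}.$$ Then $E$ is measurable up to a $P$-null set, and $$P(E)=\int_0^\infty e^{-\int_0^y(\lambda_i(y_1+t)+\lambda_j(y_2+t))\,dt}\,\big(\lambda_{ij}(y_1+y)+\lambda_{ji}(y_2+y)\big)\,dy,$$ where the integral on the right converges. -/

import Mathlib

open MeasureTheory ProbabilityTheory Filter Topology Set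
open scoped ENNReal NNReal

noncomputable section

namespace SemiMarkovFlow

/-- `N` is a Poisson random measure with intensity `ν` under `P`: an integer-valued random measure
whose value on each measurable `A` is Poisson with mean `ν A` (almost surely infinite if
`ν A = ∞`), and whose values on finitely many disjoint sets are independent. -/
structure IsPoissonRandomMeasure {Ω E : Type*} [MeasurableSpace Ω] [MeasurableSpace E]
    (P : Measure Ω) (N : Ω → Measure E) (ν : Measure E) : Prop where
  measurable : ∀ A, MeasurableSet A → Measurable fun ω => N ω A
  integer_valued : ∀ᵐ ω ∂P, ∀ A, MeasurableSet A → ∃ n : ℕ∞, N ω A = (n : ℝ≥0∞)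
  poisson : ∀ A, MeasurableSet A → ν A ≠ ∞ →
    P.map (fun ω => N ω A) = (poissonMeasure (ν A).toNNReal).map fun n : ℕ => (n : ℝ≥0∞)
  infinite : ∀ A, MeasurableSet A → ν A = ∞ → ∀ᵐ ω ∂P, N ω A = ∞
  indep : ∀ (n : ℕ) (A : Fin n → Set E), (∀ k, MeasurableSet (A k)) →
    Pairwise (fun k l => Disjoint (A k) (A l)) → iIndepFun (fun k ω => N ω (A k)) P

/-- Lebesgue measure on `[0,∞)`, as a measure on `ℝ`. -/
def halfLine : Measure ℝ := volume.restrict (Ici 0)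

/-- The set of ordered pairs of distinct states. -/
abbrev Pairs (S : Set ℝ) : Type := {p : S × S // p.1 ≠ p.2}

/-- The pair `(i, k)` with `k ≠ i`. -/
def pairTo {S : Set ℝ} (i : S) (k : {k : S // k ≠ i}) : Pairs S := ⟨(i, k.1), k.2.symm⟩

/-- The `L^∞` norm of a function on `[0,∞)`. -/
def supNorm (f : ℝ → ℝ) : ℝ := (eLpNorm f ∞ halfLine).toReal

/-- The total rate `λ_i(y) = |λ_{ii}(y)| = ∑_{k ≠ i} λ_{ik}(y)` of leaving `i` at age `y`. -/
def exitRate {S : Set ℝ} (lam : Pairs S → ℝ → ℝ) (i : S) (y : ℝ) : ℝ :=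
  ∑' k : {k : S // k ≠ i}, lam (pairTo i k) y

/-- The standing assumptions on the transition rates. Only the values at ages `y ≥ 0` matter; a
function on `[0,∞)` is represented by any measurable extension to `ℝ`. -/
structure IsRateMatrix {S : Set ℝ} (lam : Pairs S → ℝ → ℝ) : Prop where
  measurable : ∀ p, Measurable (lam p)
  pos : ∀ p, ∀ y, 0 ≤ y → 0 < lam p y
  bounded : ∀ p, ∃ M : ℝ, ∀ y, 0 ≤ y → lam p y ≤ M
  summable_norm : Summable fun p => supNorm (lam p)
  tendsto_cumulative : ∀ i : S,
    Tendsto (fun y : ℝ => ∫ t in (0 : ℝ)..y, exitRate lam i t) atTop atTop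

/-- The assumptions on the auxiliary functions `λ̃` that fix the positions of the intervals. -/
structure IsSpacing {S : Set ℝ} (lam lamT : Pairs S → ℝ → ℝ) : Prop where
  measurable : ∀ p, Measurable (lamT p)
  pos : ∀ p, ∀ y, 0 ≤ y → 0 < lamT p y
  le : ∀ p, ∀ y, 0 ≤ y → lam p y ≤ lamT p y
  le_norm : ∀ p, ∀ᵐ y ∂halfLine, lamT p y ≤ supNorm (lam p)

/-- Assumption (A3): `λ̃_p = ‖λ_p‖_∞` almost everywhere, for all `p`. -/
def AssumptionA3 {S : Set ℝ} (lam lamT : Pairs S → ℝ → ℝ) : Prop :=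
  ∀ p, ∀ᵐ y ∂halfLine, lamT p y = supNorm (lam p)

/-- The sum of `λ̃_q(y)` over the pairs `q` that precede `p`, as an extended nonnegative number. -/
def leftEnd {S : Set ℝ} (r : Pairs S → Pairs S → Prop) (lamT : Pairs S → ℝ → ℝ)
    (p : Pairs S) (y : ℝ) : ℝ≥0∞ :=
  ∑' q : {q : Pairs S // r q p}, ENNReal.ofReal (lamT q.1 y)

/-- The interval `Λ_p(y) = leftEnd + [0, λ_p(y))`, a set of real numbers. (It is empty if the left
end is infinite, which under (A1) and (A3) can happen only for a null set of ages.) -/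
def jumpInterval {S : Set ℝ} (r : Pairs S → Pairs S → Prop) (lam lamT : Pairs S → ℝ → ℝ)
    (p : Pairs S) (y : ℝ) : Set ℝ :=
  {v | 0 ≤ v ∧ leftEnd r lamT p y ≤ ENNReal.ofReal v ∧
    ENNReal.ofReal v < leftEnd r lamT p y + ENNReal.ofReal (lam p y)}

/-- `h_Λ(i,y,v) = ∑_{k ≠ i} (k - i) 1_{Λ_{ik}(y)}(v)`. -/
def hCoeff {S : Set ℝ} (r : Pairs S → Pairs S → Prop) (lam lamT : Pairs S → ℝ → ℝ)
    (i : S) (y v : ℝ) : ℝ :=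
  ∑' k : {k : S // k ≠ i},
    ((k.1 : ℝ) - (i : ℝ)) * (jumpInterval r lam lamT (pairTo i k) y).indicator 1 v

/-- `g_Λ(i,y,v) = y ∑_{k ≠ i} 1_{Λ_{ik}(y)}(v)`. -/
def gCoeff {S : Set ℝ} (r : Pairs S → Pairs S → Prop) (lam lamT : Pairs S → ℝ → ℝ)
    (i : S) (y v : ℝ) : ℝ :=
  y * ∑' k : {k : S // k ≠ i}, (jumpInterval r lam lamT (pairTo i k) y).indicator 1 v

/-- The path `x` (on times `t ≥ 0`) is a pure jump path: right continuous with left limits for the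
discrete topology of the countable state space. -/
def IsPureJumpPath {S : Set ℝ} (x : ℝ → S) : Prop :=
  (∀ t, 0 ≤ t → ∀ᶠ s in 𝓝[>] t, x s = x t) ∧
  (∀ t, 0 < t → ∃ k : S, ∀ᶠ s in 𝓝[<] t, x s = k)

/-- The path `(x, y)` solves
`x_t = x_0 + ∫_{(0,t]×ℝ} h_Λ(x_{u-}, y_{u-}, v) μ(du,dv)`,
`y_t = y_0 + t - ∫_{(0,t]×ℝ} g_Λ(x_{u-}, y_{u-}, v) μ(du,dv)` for all `t > 0`,
with `x_0 = i` and `y_0 = a`, both integrals being absolutely convergent. -/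
structure IsSolutionPath {S : Set ℝ} (r : Pairs S → Pairs S → Prop) (lam lamT : Pairs S → ℝ → ℝ)
    (μ : Measure (ℝ × ℝ)) (i : S) (a : ℝ) (x : ℝ → S) (y : ℝ → ℝ) : Prop where
  init_state : x 0 = i
  init_age : y 0 = a
  age_nonneg : ∀ t, 0 ≤ t → 0 ≤ y t
  pure_jump : IsPureJumpPath x
  integrable_h : ∀ t, 0 < t → IntegrableOn
    (fun z : ℝ × ℝ => hCoeff r lam lamT (Function.leftLim x z.1) (Function.leftLim y z.1) z.2)
    (Ioc 0 t ×ˢ univ) μ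
  integrable_g : ∀ t, 0 < t → IntegrableOn
    (fun z : ℝ × ℝ => gCoeff r lam lamT (Function.leftLim x z.1) (Function.leftLim y z.1) z.2)
    (Ioc 0 t ×ˢ univ) μ
  state_eq : ∀ t, 0 < t → (x t : ℝ) = (x 0 : ℝ) +
    ∫ z in Ioc 0 t ×ˢ univ,
      hCoeff r lam lamT (Function.leftLim x z.1) (Function.leftLim y z.1) z.2 ∂μ
  age_eq : ∀ t, 0 < t → y t = y 0 + t -
    ∫ z in Ioc 0 t ×ˢ univ,
      gCoeff r lam lamT (Function.leftLim x z.1) (Function.leftLim y z.1) z.2 ∂μ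

/-- The process `(X, Y)` is a solution, driven by the random measure `N`, of the system of
stochastic differential equations, with initial state `i` and initial age `a`. -/
def IsSolution {Ω : Type*} [MeasurableSpace Ω] (P : Measure Ω) {S : Set ℝ}
    (r : Pairs S → Pairs S → Prop) (lam lamT : Pairs S → ℝ → ℝ)
    (N : Ω → Measure (ℝ × ℝ)) (i : S) (a : ℝ) (X : ℝ → Ω → S) (Y : ℝ → Ω → ℝ) : Prop :=
  ∀ᵐ ω ∂P, IsSolutionPath r lam lamT (N ω) i a (fun t => X t ω) (fun t => Y t ω)

/-- The transition times of a path: the times `t > 0` with `x_{t-} ≠ x_t`. -/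
def transitionTimes {S : Set ℝ} (x : ℝ → S) : Set ℝ :=
  {t | 0 < t ∧ Function.leftLim x t ≠ x t}

/-- The collective transition times `T_0 = 0`,
`T_{n+1} = inf {t > T_n : t is a transition time of x₁ or of x₂}` (`+∞` if there is none). -/
def collectiveTime {S : Set ℝ} (x₁ x₂ : ℝ → S) : ℕ → EReal
  | 0 => 0
  | n + 1 => sInf {t : EReal | collectiveTime x₁ x₂ n < t ∧
      ∃ s ∈ transitionTimes x₁ ∪ transitionTimes x₂, t = (s : EReal)}

/-- The event that the two processes meet at the next (the first) collective transition: `T_1` is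
finite, and at time `T_1` the states agree and the smaller of the two ages is `0`. -/
def meetsAtNextTransition {Ω : Type*} {S : Set ℝ} (X₁ X₂ : ℝ → Ω → S) (Y₁ Y₂ : ℝ → Ω → ℝ) :
    Set Ω :=
  {ω | ∃ T : ℝ, collectiveTime (fun t => X₁ t ω) (fun t => X₂ t ω) 1 = (T : EReal) ∧
    X₁ T ω = X₂ T ω ∧ min (Y₁ T ω) (Y₂ T ω) = 0}

end SemiMarkovFlow

end

/-!
As long as neither process has jumped, `X¹` stays at `i` with age `y₁ + t` and `X²` stays at `j`
with age `y₂ + t`. So the first collective transition happens at the first point of `N` in the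
region `U` of all `(t, v)` with `v` in some `Λ_{ik}(y₁ + t)` or some `Λ_{jk}(y₂ + t)`, and the
processes meet there exactly if this point lies in the part `C` of `U` where `v` is in
`Λ_{ij}(y₁ + t)` or in `Λ_{ji}(y₂ + t)`. By (A3), for almost all `t` all the intervals involved
are disjoint, and they have the lengths `λ_{ik}(y₁ + t)` and `λ_{jk}(y₂ + t)`. Hence almost
surely only one process jumps at a time, and the slices of `U` and `C` at `t` have measures
`λ_i(y₁ + t) + λ_j(y₂ + t)` and `λ_{ij}(y₁ + t) + λ_{ji}(y₂ + t)`.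

It remains to see that the first point of a Poisson random measure with intensity `ν` in `U`
lies in `C` with probability `∫_C e^{-ν(U ∩ [0, t])} dν`. Cut time into cells of mesh `δ`. If
`ν` charges `U` at a rate of at most `c` per unit of time, then up to a factor `e^{±cδ}` the
integral over the points of one cell is the probability that `U` is empty before the cell and
`C` is hit in the cell, as well as the probability that in addition no other point of `U` is hit
in the cell. The events of the first kind cover the event in question, those of the second kind
are disjoint and contained in it. Let `δ → 0`.
-/

noncomputable section

namespace SemiMarkovFlow

/-! ### Integer-valued measures -/

/-- A measure all of whose values on measurable sets are natural numbers or `∞`; the realizations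
of a Poisson random measure are of this kind. -/
def IntegerValued {E : Type*} [MeasurableSpace E] (μ : Measure E) : Prop :=
  ∀ A, MeasurableSet A → ∃ n : ℕ∞, μ A = (n : ℝ≥0∞)

namespace IntegerValued

variable {E F : Type*} [MeasurableSpace E] [MeasurableSpace F] {μ : Measure E} {A B : Set E}

lemma one_le (hμ : IntegerValued μ) (hA : MeasurableSet A) (h : μ A ≠ 0) : 1 ≤ μ A := by
  obtain ⟨n, hn⟩ := hμ A hA
  rw [hn] at h ⊢
  exact_mod_cast Order.one_le_iff_ne_zero.2 (by simpa using h)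

lemma restrict (hμ : IntegerValued μ) (hA : MeasurableSet A) : IntegerValued (μ.restrict A) :=
  fun B hB => by simpa only [Measure.restrict_apply hB] using hμ (B ∩ A) (hB.inter hA)

lemma map (hμ : IntegerValued μ) {f : E → F} (hf : Measurable f) : IntegerValued (μ.map f) :=
  fun B hB => by simpa only [Measure.map_apply hf hB] using hμ (f ⁻¹' B) (hf hB)

lemma measure_diff_eq_zero (hμ : IntegerValued μ) (hA : MeasurableSet A) (hAB : A ⊆ B)
    (hB : μ B ≤ 1) (h0 : μ A ≠ 0) : μ (B \ A) = 0 := by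
  have hAB' : μ B ≤ μ A := hB.trans (hμ.one_le hA h0)
  rw [measure_sdiff hAB hA.nullMeasurableSet (ne_top_of_le_ne_top ENNReal.one_ne_top
    ((measure_mono hAB).trans hB)), tsub_eq_zero_of_le hAB']

lemma exists_first_atom {κ : Measure ℝ} [IsFiniteMeasure κ] (hκ : IntegerValued κ) (h0 : κ ≠ 0) :
    ∃ T, κ (Iio T) = 0 ∧ κ {T} ≠ 0 := by
  set V : Set ℝ := {u | κ (Iic u) ≠ 0}
  have hV_mono : ∀ {u v}, u ≤ v → u ∈ V → v ∈ V := fun huv hu hv =>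
    hu (measure_mono_null (Iic_subset_Iic.2 huv) hv)
  have hV_nonempty : V.Nonempty := by
    by_contra! hempty
    refine h0 (Measure.measure_univ_eq_zero.1 ?_)
    have hzero (u : ℝ) : κ (Iic u) = 0 := not_not.1 (eq_empty_iff_forall_notMem.1 hempty u)
    exact tendsto_nhds_unique (tendsto_measure_Iic_atTop κ) (by simp [hzero])
  have hV_bddBelow : BddBelow V := by
    have hlim : Tendsto (fun u => κ (Iic u)) atBot (𝓝 0) := by
      simpa [Function.comp_def, iInter_Iic_eq_empty_iff.2] using
        tendsto_measure_iInter_atBot (μ := κ) (fun u => measurableSet_Iic.nullMeasurableSet)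
          monotone_Iic ⟨0, measure_ne_top κ _⟩
    obtain ⟨b, hb⟩ := (hlim.eventually (gt_mem_nhds one_pos)).exists
    exact ⟨b, fun u hu => le_of_not_ge fun hub =>
      (hκ.one_le measurableSet_Iic (hV_mono hub hu)).not_gt hb⟩
  have h_before : κ (Iio (sInf V)) = 0 := by
    refine measure_null_of_locally_null _ fun u hu => ?_
    obtain ⟨v, huv, hv⟩ := exists_between (mem_Iio.1 hu)
    exact ⟨Iic v, mem_nhdsWithin_of_mem_nhds (Iic_mem_nhds huv),
      by_contra fun h => notMem_of_lt_csInf hv hV_bddBelow h⟩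
  have h_upto : 1 ≤ κ (Iic (sInf V)) := by
    have hlim := tendsto_measure_biInter_gt (μ := κ) (s := Iic) (a := sInf V)
      (fun r _ => measurableSet_Iic.nullMeasurableSet) (fun _ _ _ h => Iic_subset_Iic.2 h)
      ⟨sInf V + 1, by simp, measure_ne_top κ _⟩
    have hInter : ⋂ u > sInf V, Iic u = Iic (sInf V) := by
      ext u; simpa using ⟨le_of_forall_gt_imp_ge_of_dense, fun h v hv => h.trans hv.le⟩
    rw [hInter] at hlim
    refine ge_of_tendsto hlim (eventually_mem_nhdsWithin.mono fun u hu => ?_)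
    obtain ⟨v, hv, hvu⟩ := exists_lt_of_csInf_lt hV_nonempty hu
    exact hκ.one_le measurableSet_Iic (hV_mono hvu.le hv)
  refine ⟨sInf V, h_before, fun hT => ?_⟩
  have : κ (Iic (sInf V)) = 0 := by
    rw [← Iio_union_right, measure_union_null h_before hT]
  exact absurd h_upto (by simp [this])

lemma exists_first_slice {μ : Measure (ℝ × E)} (hμ : IntegerValued μ) {H : Set (ℝ × E)}
    (hH : MeasurableSet H) (h0 : μ H ≠ 0) (hfin : μ H ≠ ∞) :
    ∃ T, μ (H ∩ Prod.fst ⁻¹' Iio T) = 0 ∧ μ (H ∩ Prod.fst ⁻¹' {T}) ≠ 0 := by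
  have hmap {A : Set ℝ} (hA : MeasurableSet A) :
      (μ.restrict H).map Prod.fst A = μ (H ∩ Prod.fst ⁻¹' A) := by
    rw [Measure.map_apply measurable_fst hA, Measure.restrict_apply (measurable_fst hA), inter_comm]
  have : IsFiniteMeasure ((μ.restrict H).map Prod.fst) :=
    ⟨by simpa [hmap MeasurableSet.univ] using hfin.lt_top⟩
  obtain ⟨T, hT, hT'⟩ := ((hμ.restrict hH).map measurable_fst).exists_first_atom
    (fun h => h0 (by simpa [h] using (hmap MeasurableSet.univ).symm))
  exact ⟨T, by rwa [← hmap measurableSet_Iio], by rwa [← hmap (measurableSet_singleton T)]⟩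

lemma ae_eq_zero_of_forall_slice {μ : Measure (ℝ × E)} (hμ : IntegerValued μ) {G : ℝ × E → ℝ}
    (hG : Integrable G μ) (hslice : ∀ u, ∀ᵐ z ∂μ.restrict (Prod.fst ⁻¹' {u}), G z = 0) :
    G =ᵐ[μ] 0 := by
  obtain ⟨G', hG'_meas, hGG'⟩ := hG.1.aemeasurable
  have hG'_ge (n : ℕ) : MeasurableSet {z | 1 / ((n : ℝ) + 1) ≤ ‖G' z‖} :=
    measurableSet_le measurable_const hG'_meas.norm
  have hnull (n : ℕ) : μ {z | 1 / ((n : ℝ) + 1) ≤ ‖G' z‖} = 0 := by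
    by_contra h0
    obtain ⟨T, -, hT⟩ := hμ.exists_first_slice (hG'_ge n) h0
      ((hG.congr hGG').measure_norm_ge_lt_top (by positivity)).ne
    rw [← Measure.restrict_apply (hG'_ge n)] at hT
    refine hT (measure_eq_zero_iff_ae_notMem.2 ?_)
    filter_upwards [hslice T, ae_restrict_of_ae hGG'] with z hz hz'
    rw [← hz', hz, norm_zero, not_le]
    positivity
  filter_upwards [hGG', ae_all_iff.2 fun n => measure_eq_zero_iff_ae_notMem.1 (hnull n)]
    with z hz hn
  by_contra hne
  obtain ⟨n, hn'⟩ := exists_nat_one_div_lt (norm_pos_iff.2 (hz ▸ hne))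
  exact hn n hn'.le

end IntegerValued

section LeftLimits

variable {E F : Type*} [MeasurableSpace E] [NormedAddCommGroup F] [NormedSpace ℝ F]
  {μ : Measure (ℝ × E)} {G : ℝ × E → F}

lemma tendsto_setIntegral_Ioc_nhdsLT {t : ℝ} (ht : 0 < t)
    (hG : IntegrableOn G (Prod.fst ⁻¹' Ioc 0 t) μ) :
    Tendsto (fun u => ∫ z in Prod.fst ⁻¹' Ioc 0 u, G z ∂μ) (𝓝[<] t)
      (𝓝 (∫ z in Prod.fst ⁻¹' Ioc 0 t, G z ∂μ - ∫ z in Prod.fst ⁻¹' {t}, G z ∂μ)) := by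
  have hunion : ⋃ u : Iio t, Prod.fst (β := E) ⁻¹' Ioc 0 (u : ℝ) = Prod.fst ⁻¹' Ioo 0 t := by
    ext z
    simp only [mem_iUnion, mem_preimage, mem_Ioc, mem_Ioo, Subtype.exists, mem_Iio]
    exact ⟨fun ⟨u, hu, h0, hzu⟩ => ⟨h0, hzu.trans_lt hu⟩, fun h => ⟨z.1, h.2, h.1, le_rfl⟩⟩
  have hsplit : Prod.fst (β := E) ⁻¹' Ioc 0 t = Prod.fst ⁻¹' Ioo 0 t ∪ Prod.fst ⁻¹' {t} := by
    rw [← preimage_union, Ioo_union_right ht]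
  have hdisj : Disjoint (Prod.fst (β := E) ⁻¹' Ioo 0 t) (Prod.fst ⁻¹' {t}) :=
    Disjoint.preimage _ (by simp)
  have hIoo : IntegrableOn G (⋃ u : Iio t, Prod.fst ⁻¹' Ioc 0 (u : ℝ)) μ :=
    hunion ▸ hG.mono_set (preimage_mono Ioo_subset_Ioc_self)
  rw [hsplit] at hG ⊢
  rw [setIntegral_union hdisj (measurable_fst (measurableSet_singleton t))
    hG.left_of_union hG.right_of_union, add_sub_cancel_right, ← hunion,
    ← tendsto_comp_coe_Iio_atTop]
  exact tendsto_setIntegral_of_monotone (fun u => measurable_fst measurableSet_Ioc)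
    (fun u v huv => preimage_mono (Ioc_subset_Ioc_right huv)) hIoo

end LeftLimits

/-! ### Jump intervals -/

section JumpIntervals

variable {S : Set ℝ} {r : Pairs S → Pairs S → Prop} {lam lamT : Pairs S → ℝ → ℝ} {p q : Pairs S}
  {i : S} {y y' v : ℝ}

lemma pairTo_injective (i : S) : Function.Injective (pairTo i) := fun k l h => by
  simpa [pairTo, Subtype.ext_iff] using h

lemma leftEnd_add_le [IsStrictTotalOrder (Pairs S) r] (hpq : r p q) (y : ℝ) :
    leftEnd r lamT p y + ENNReal.ofReal (lamT p y) ≤ leftEnd r lamT q y := by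
  set f : Pairs S → ℝ≥0∞ := fun q => ENNReal.ofReal (lamT q y)
  have hp : p ∉ {s | r s p} := irrefl p
  have hsub : {p} ∪ {s | r s p} ⊆ {s | r s q} :=
    union_subset (singleton_subset_iff.2 hpq) fun s hs => _root_.trans hs hpq
  calc leftEnd r lamT p y + f p = ∑' s : ({p} ∪ {s | r s p} : Set (Pairs S)), f s := by
        rw [ENNReal.summable.tsum_union_disjoint (f := f) (by simpa using hp) ENNReal.summable,
          tsum_singleton p f, add_comm]
        rfl
    _ ≤ ∑' s : {s | r s q}, f s := ENNReal.tsum_mono_subtype f hsub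

lemma ofReal_lt_leftEnd [IsStrictTotalOrder (Pairs S) r] (hle : lam p y ≤ lamT p y) (hpq : r p q)
    (hv : v ∈ jumpInterval r lam lamT p y) : ENNReal.ofReal v < leftEnd r lamT q y :=
  calc ENNReal.ofReal v < leftEnd r lamT p y + ENNReal.ofReal (lam p y) := hv.2.2
    _ ≤ leftEnd r lamT p y + ENNReal.ofReal (lamT p y) := by gcongr
    _ ≤ leftEnd r lamT q y := leftEnd_add_le hpq y

lemma disjoint_jumpInterval [IsStrictTotalOrder (Pairs S) r] (hle : ∀ q, lam q y ≤ lamT q y)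
    (hle' : ∀ q, lam q y' ≤ lamT q y') (heq : ∀ q, lamT q y = lamT q y') (hpq : p ≠ q) :
    Disjoint (jumpInterval r lam lamT p y) (jumpInterval r lam lamT q y') := by
  have hleft (s : Pairs S) : leftEnd r lamT s y = leftEnd r lamT s y' := by simp [leftEnd, heq]
  refine Set.disjoint_left.2 fun v hp hq => ?_
  rcases trichotomous_of r p q with h | h | h
  · exact (ofReal_lt_leftEnd (hle p) h hp).not_ge (hleft q ▸ hq.2.1)
  · exact hpq h
  · exact (ofReal_lt_leftEnd (hle' q) h hq).not_ge (hleft p ▸ hp.2.1)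

lemma measurableSet_mem_jumpInterval [Countable S] (hlam : ∀ p, Measurable (lam p))
    (hlamT : ∀ p, Measurable (lamT p)) (p : Pairs S) :
    MeasurableSet {z : ℝ × ℝ | z.2 ∈ jumpInterval r lam lamT p z.1} := by
  have h_left : Measurable fun z : ℝ × ℝ => leftEnd r lamT p z.1 :=
    (Measurable.tsum fun q : {q // r q p} => (hlamT q.1).ennreal_ofReal).comp measurable_fst
  have h_rate : Measurable fun z : ℝ × ℝ => ENNReal.ofReal (lam p z.1) :=
    ((hlam p).comp measurable_fst).ennreal_ofReal
  have h_mark : Measurable fun z : ℝ × ℝ => ENNReal.ofReal z.2 := measurable_snd.ennreal_ofReal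
  exact (measurableSet_le measurable_const measurable_snd).inter
    ((measurableSet_le h_left h_mark).inter (measurableSet_lt h_mark (h_left.add h_rate)))

lemma measurableSet_jumpInterval (p : Pairs S) (y : ℝ) :
    MeasurableSet (jumpInterval r lam lamT p y) :=
  measurableSet_Ici.inter ((measurableSet_le measurable_const ENNReal.measurable_ofReal).inter
    (measurableSet_lt ENNReal.measurable_ofReal measurable_const))

variable (r lam lamT) in
/-- The set of marks on which a process in state `i` and of age `y` jumps. -/
def hitSet (i : S) (y : ℝ) : Set ℝ :=
  ⋃ k : {k : S // k ≠ i}, jumpInterval r lam lamT (pairTo i k) y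

lemma measurableSet_mem_hitSet [Countable S] (hlam : ∀ p, Measurable (lam p))
    (hlamT : ∀ p, Measurable (lamT p)) (i : S) :
    MeasurableSet {z : ℝ × ℝ | z.2 ∈ hitSet r lam lamT i z.1} := by
  simp only [hitSet, mem_iUnion, ofPred_exists]
  exact MeasurableSet.iUnion fun k => measurableSet_mem_jumpInterval hlam hlamT (pairTo i k)

lemma measurableSet_hitSet [Countable S] (i : S) (y : ℝ) :
    MeasurableSet (hitSet r lam lamT i y) :=
  MeasurableSet.iUnion fun _ => measurableSet_jumpInterval _ _

lemma notMem_jumpInterval_of_ne [IsStrictTotalOrder (Pairs S) r] (hle : ∀ q, lam q y ≤ lamT q y)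
    {k l : {k : S // k ≠ i}} (hv : v ∈ jumpInterval r lam lamT (pairTo i k) y) (hlk : l ≠ k) :
    v ∉ jumpInterval r lam lamT (pairTo i l) y :=
  Set.disjoint_left.1
    (disjoint_jumpInterval hle hle (fun _ => rfl) ((pairTo_injective i).ne hlk.symm)) hv

lemma hCoeff_of_mem [IsStrictTotalOrder (Pairs S) r] (hle : ∀ q, lam q y ≤ lamT q y)
    {k : {k : S // k ≠ i}} (hv : v ∈ jumpInterval r lam lamT (pairTo i k) y) :
    hCoeff r lam lamT i y v = (k.1 : ℝ) - i := by
  rw [hCoeff, tsum_eq_single k fun l hl => by simp [notMem_jumpInterval_of_ne hle hv hl]]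
  simp [hv]

lemma hCoeff_of_notMem (hv : v ∉ hitSet r lam lamT i y) : hCoeff r lam lamT i y v = 0 := by
  simp only [hitSet, mem_iUnion, not_exists] at hv
  simp [hCoeff, hv]

lemma gCoeff_eq_indicator [IsStrictTotalOrder (Pairs S) r] (hle : ∀ q, lam q y ≤ lamT q y)
    (v : ℝ) : gCoeff r lam lamT i y v = (hitSet r lam lamT i y).indicator (fun _ => y) v := by
  by_cases hv : v ∈ hitSet r lam lamT i y
  · obtain ⟨k, hk⟩ := mem_iUnion.1 hv
    rw [gCoeff, tsum_eq_single k fun l hl => by simp [notMem_jumpInterval_of_ne hle hk hl]]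
    simp [hv, hk]
  · have hv' := hv
    simp only [hitSet, mem_iUnion, not_exists] at hv'
    simp [gCoeff, hv, hv']

end JumpIntervals

section AgeRegions

/-- The points `(t, v)` with `t > 0` whose mark `v` lies in `A (a + t)`, where `a + t` is the age at
time `t` of a process which starts with age `a` and has not jumped before time `t`. -/
def ageRegion (A : ℝ → Set ℝ) (a : ℝ) : Set (ℝ × ℝ) := {z | 0 < z.1 ∧ z.2 ∈ A (a + z.1)}

variable {A : ℝ → Set ℝ} {a t : ℝ}

lemma measurableSet_ageRegion (hA : MeasurableSet {z : ℝ × ℝ | z.2 ∈ A z.1}) (a : ℝ) :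
    MeasurableSet (ageRegion A a) :=
  (measurableSet_lt measurable_const measurable_fst).inter
    ((by fun_prop : Measurable fun z : ℝ × ℝ => (a + z.1, z.2)) hA)

lemma ageRegion_inter_slice (ht : 0 < t) :
    ageRegion A a ∩ Prod.fst ⁻¹' {t} = {t} ×ˢ A (a + t) := by
  ext z
  constructor
  · rintro ⟨⟨-, hz⟩, rfl⟩
    exact ⟨rfl, hz⟩
  · rintro ⟨rfl, hz⟩
    exact ⟨⟨ht, hz⟩, rfl⟩

lemma pos_of_measure_ageRegion_slice_ne_zero {μ : Measure (ℝ × ℝ)}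
    (h : μ (ageRegion A a ∩ Prod.fst ⁻¹' {t}) ≠ 0) : 0 < t := by
  obtain ⟨z, hz, rfl⟩ := nonempty_of_measure_ne_zero h
  exact hz.1

end AgeRegions

/-! ### Pure jump paths and the first collective transition -/

lemma leftLim_eq_of_eqOn_const {α : Type*} [TopologicalSpace α] [T2Space α] {f : ℝ → α} {c : α}
    {s t : ℝ} (hst : s < t) (hf : ∀ u ∈ Ico s t, f u = c) : Function.leftLim f t = c := by
  refine leftLim_eq_of_tendsto (tendsto_const_nhds.congr' ?_)
  filter_upwards [Ioo_mem_nhdsLT hst] with u hu using (hf u (Ioo_subset_Ico_self hu)).symm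

section JumpPaths

variable {S : Set ℝ} {x x₁ x₂ : ℝ → S}

namespace IsPureJumpPath

lemma eventually_eq_leftLim (hx : IsPureJumpPath x) {t : ℝ} (ht : 0 < t) :
    ∀ᶠ u in 𝓝[<] t, x u = Function.leftLim x t := by
  obtain ⟨k, hk⟩ := hx.2 t ht
  rwa [leftLim_eq_of_tendsto (tendsto_const_nhds.congr' (hk.mono fun u hu => hu.symm))]

lemma exists_first_exit (hx : IsPureJumpPath x) {s : ℝ} (hs : 0 ≤ s) (hne : x s ≠ x 0) :
    ∃ T ∈ Ioc 0 s, (∀ u ∈ Ico 0 T, x u = x 0) ∧ x T ≠ x 0 := by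
  set K : Set ℝ := {u | 0 ≤ u ∧ x u ≠ x 0}
  have hsK : s ∈ K := ⟨hs, hne⟩
  have hK : BddBelow K := ⟨0, fun u hu => hu.1⟩
  have hT₀ : 0 ≤ sInf K := le_csInf ⟨s, hsK⟩ fun u hu => hu.1
  have hT : x (sInf K) ≠ x 0 := by
    intro hT
    obtain ⟨b, hb, hxb⟩ := mem_nhdsGT_iff_exists_Ioo_subset.1 (hx.1 (sInf K) hT₀)
    obtain ⟨u, hu, hub⟩ := exists_lt_of_csInf_lt ⟨s, hsK⟩ hb
    rcases (csInf_le hK hu).eq_or_lt with h | h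
    · exact hu.2 (h ▸ hT)
    · exact hu.2 ((hxb ⟨h, hub⟩ : x u = x (sInf K)).trans hT)
  refine ⟨sInf K, ⟨hT₀.lt_of_ne fun h => hT (h ▸ rfl), csInf_le hK hsK⟩, fun u hu => ?_, hT⟩
  by_contra hne
  exact (csInf_le hK ⟨hu.1, hne⟩).not_gt hu.2

end IsPureJumpPath

lemma collectiveTime_one_comm (x₁ x₂ : ℝ → S) :
    collectiveTime x₁ x₂ 1 = collectiveTime x₂ x₁ 1 := by
  simp [collectiveTime, or_comm]

lemma collectiveTime_one_nonneg (x₁ x₂ : ℝ → S) : 0 ≤ collectiveTime x₁ x₂ 1 :=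
  le_sInf fun _ ht => ht.1.le

lemma collectiveTime_one_le {s : ℝ} (hs : s ∈ transitionTimes x₁ ∪ transitionTimes x₂) :
    collectiveTime x₁ x₂ 1 ≤ s :=
  sInf_le ⟨EReal.coe_pos.2 (hs.elim And.left And.left), s, hs, rfl⟩

lemma IsPureJumpPath.eq_of_lt_collectiveTime (hx : IsPureJumpPath x₁) {u : ℝ} (hu : 0 ≤ u)
    (huT : u < collectiveTime x₁ x₂ 1) : x₁ u = x₁ 0 := by
  by_contra hne
  obtain ⟨T, hT, hbefore, hxT⟩ := hx.exists_first_exit hu hne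
  have hT_mem : T ∈ transitionTimes x₁ :=
    ⟨hT.1, by rw [leftLim_eq_of_eqOn_const hT.1 hbefore]; exact hxT.symm⟩
  exact (huT.trans_le (collectiveTime_one_le (Or.inl hT_mem))).not_ge (EReal.coe_le_coe hT.2)

lemma collectiveTime_one_eq {i j : S} {T : ℝ} (hT : 0 < T) (h₁ : ∀ u ∈ Ico 0 T, x₁ u = i)
    (h₂ : ∀ u ∈ Ico 0 T, x₂ u = j) (hne : x₁ T ≠ i) : collectiveTime x₁ x₂ 1 = T := by
  have hT_mem : T ∈ transitionTimes x₁ :=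
    ⟨hT, by rw [leftLim_eq_of_eqOn_const hT h₁]; exact hne.symm⟩
  refine le_antisymm (collectiveTime_one_le (Or.inl hT_mem)) (le_sInf ?_)
  have no_transition {x : ℝ → S} {k : S} (hx : ∀ u ∈ Ico 0 T, x u = k) {s : ℝ}
      (hs : s ∈ transitionTimes x) : T ≤ s := by
    by_contra! hsT
    refine hs.2 ?_
    rw [leftLim_eq_of_eqOn_const hs.1 fun u hu => hx u ⟨hu.1, hu.2.trans hsT⟩, hx s ⟨hs.1.le, hsT⟩]
  rintro _ ⟨-, s, hs, rfl⟩
  exact EReal.coe_le_coe (hs.elim (no_transition h₁) (no_transition h₂))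

end JumpPaths

/-! ### Solution paths up to their first jump -/

section Slices

variable {E F : Type*} [MeasurableSpace E] [NormedAddCommGroup F] {μ : Measure (ℝ × E)}
  {A : Set E}

lemma setIntegral_slice_congr [NormedSpace ℝ F] (G : ℝ → E → F) (t : ℝ) :
    ∫ z in Prod.fst ⁻¹' {t}, G z.1 z.2 ∂μ = ∫ z in Prod.fst ⁻¹' {t}, G t z.2 ∂μ :=
  setIntegral_congr_fun (measurable_fst (measurableSet_singleton t)) fun z hz => by
    rw [show z.1 = t from hz]

lemma setIntegral_slice_indicator_const [NormedSpace ℝ F] [CompleteSpace F] (hA : MeasurableSet A)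
    (t : ℝ) (b : F) :
    ∫ z in Prod.fst ⁻¹' {t}, A.indicator (fun _ => b) z.2 ∂μ = μ.real ({t} ×ˢ A) • b := by
  change ∫ z in Prod.fst ⁻¹' {t}, (Prod.snd ⁻¹' A).indicator (fun _ => b) z ∂μ = _
  rw [setIntegral_indicator (measurable_snd hA), setIntegral_const, Set.prod_eq]

lemma measure_slice_ne_top_of_integrableOn (hA : MeasurableSet A) {t : ℝ} {b : F} (hb : b ≠ 0)
    (h : IntegrableOn (fun z => A.indicator (fun _ => b) z.2) (Prod.fst ⁻¹' {t}) μ) :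
    μ ({t} ×ˢ A) ≠ ∞ := by
  change IntegrableOn ((Prod.snd ⁻¹' A).indicator fun _ => b) (Prod.fst ⁻¹' {t}) μ at h
  rw [IntegrableOn, integrable_indicator_iff (measurable_snd hA), IntegrableOn,
    Measure.restrict_restrict (measurable_snd hA), integrable_const_iff_isFiniteMeasure hb,
    isFiniteMeasure_restrict, inter_comm] at h
  exact h

end Slices

namespace IsSolutionPath

variable {S : Set ℝ} {r : Pairs S → Pairs S → Prop} {lam lamT : Pairs S → ℝ → ℝ}
  {μ : Measure (ℝ × ℝ)} {i : S} {a : ℝ} {x : ℝ → S} {y : ℝ → ℝ} {t : ℝ}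

lemma tendsto_age (h : IsSolutionPath r lam lamT μ i a x y) (ht : 0 < t) :
    Tendsto y (𝓝[<] t) (𝓝 (y t + ∫ z in Prod.fst ⁻¹' {t},
      gCoeff r lam lamT (Function.leftLim x t) (Function.leftLim y t) z.2 ∂μ)) := by
  have hint := h.integrable_g t ht
  have hy := h.age_eq
  simp only [prod_univ] at hint hy
  have hlim := ((tendsto_id.mono_left nhdsWithin_le_nhds : Tendsto id (𝓝[<] t) (𝓝 t)).const_add
    (y 0)).sub (tendsto_setIntegral_Ioc_nhdsLT ht hint)
  rw [← setIntegral_slice_congr fun u v =>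
    gCoeff r lam lamT (Function.leftLim x u) (Function.leftLim y u) v, hy t ht, sub_add]
  refine hlim.congr' ?_
  filter_upwards [Ioo_mem_nhdsLT ht] with u hu using (hy u hu.1).symm

lemma leftLim_age_eq (h : IsSolutionPath r lam lamT μ i a x y) (ht : 0 < t) :
    Function.leftLim y t = y t + ∫ z in Prod.fst ⁻¹' {t},
      gCoeff r lam lamT (Function.leftLim x t) (Function.leftLim y t) z.2 ∂μ :=
  leftLim_eq_of_tendsto (h.tendsto_age ht)

lemma leftLim_age_nonneg (h : IsSolutionPath r lam lamT μ i a x y) (ht : 0 < t) :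
    0 ≤ Function.leftLim y t := by
  have hlim := h.tendsto_age ht
  rw [← h.leftLim_age_eq ht] at hlim
  refine ge_of_tendsto hlim ?_
  filter_upwards [Ioo_mem_nhdsLT ht] with u hu using h.age_nonneg u hu.1.le

lemma leftLim_state_eq (h : IsSolutionPath r lam lamT μ i a x y) (ht : 0 < t) :
    ((Function.leftLim x t : S) : ℝ) = x t - ∫ z in Prod.fst ⁻¹' {t},
      hCoeff r lam lamT (Function.leftLim x t) (Function.leftLim y t) z.2 ∂μ := by
  have hint := h.integrable_h t ht
  have hx := h.state_eq
  simp only [prod_univ] at hint hx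
  have hlim := (tendsto_setIntegral_Ioc_nhdsLT ht hint).const_add (x 0 : ℝ)
  rw [← setIntegral_slice_congr fun u v =>
    hCoeff r lam lamT (Function.leftLim x u) (Function.leftLim y u) v, hx t ht, add_sub_assoc]
  refine tendsto_nhds_unique (tendsto_const_nhds.congr' ?_) hlim
  filter_upwards [Ioo_mem_nhdsLT ht, h.pure_jump.eventually_eq_leftLim ht] with u hu hxu
  rw [← hxu, hx u hu.1]

variable {b : ℝ}

lemma measure_slice_hitSet_le_one [Countable S] [IsStrictTotalOrder (Pairs S) r]
    (hle : ∀ p y, 0 ≤ y → lam p y ≤ lamT p y) (h : IsSolutionPath r lam lamT μ i a x y)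
    (ht : 0 < t) (hx : ∀ u ∈ Ico 0 t, x u = i) (hb : Function.leftLim y t = b) (hb₀ : 0 < b) :
    μ ({t} ×ˢ hitSet r lam lamT i b) ≤ 1 := by
  have hxt := leftLim_eq_of_eqOn_const ht hx
  have hg (v : ℝ) : gCoeff r lam lamT i b v = (hitSet r lam lamT i b).indicator (fun _ => b) v :=
    gCoeff_eq_indicator (fun q => hle q b hb₀.le) v
  have hint : IntegrableOn (fun z => (hitSet r lam lamT i b).indicator (fun _ => b) z.2)
      (Prod.fst ⁻¹' {t}) μ := by
    refine ((h.integrable_g t ht).mono_set (fun z hz => ?_)).congr_fun (fun z hz => ?_)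
      (measurable_fst (measurableSet_singleton t))
    · exact ⟨by rw [show z.1 = t from hz]; exact ⟨ht, le_rfl⟩, trivial⟩
    · simp only [show z.1 = t from hz, hxt, hb, hg]
  have hage := h.leftLim_age_eq ht
  simp only [hxt, hb, hg, setIntegral_slice_indicator_const (measurableSet_hitSet i b),
    smul_eq_mul] at hage
  have hreal : μ.real ({t} ×ˢ hitSet r lam lamT i b) ≤ 1 :=
    le_of_mul_le_mul_right (by linarith [h.age_nonneg t ht.le]) hb₀
  rw [← ENNReal.toReal_le_toReal (measure_slice_ne_top_of_integrableOn (measurableSet_hitSet i b)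
    hb₀.ne' hint) ENNReal.one_ne_top]
  simpa only [ENNReal.toReal_one, measureReal_def] using hreal

lemma jump_of_slice_ne_zero [Countable S] [IsStrictTotalOrder (Pairs S) r]
    (hle : ∀ p y, 0 ≤ y → lam p y ≤ lamT p y) (hμ : IntegerValued μ)
    (h : IsSolutionPath r lam lamT μ i a x y) (ht : 0 < t) (hx : ∀ u ∈ Ico 0 t, x u = i)
    (hb : Function.leftLim y t = b) (hb₀ : 0 < b) {k : {k : S // k ≠ i}}
    (hk : μ ({t} ×ˢ jumpInterval r lam lamT (pairTo i k) b) ≠ 0) : x t = k ∧ y t = 0 := by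
  have hle_b (q : Pairs S) : lam q b ≤ lamT q b := hle q b hb₀.le
  have hxt := leftLim_eq_of_eqOn_const ht hx
  have hmeas : MeasurableSet ({t} ×ˢ jumpInterval r lam lamT (pairTo i k) b) :=
    (measurableSet_singleton t).prod (measurableSet_jumpInterval _ b)
  have hsub : {t} ×ˢ jumpInterval r lam lamT (pairTo i k) b ⊆ {t} ×ˢ hitSet r lam lamT i b :=
    prod_mono_right (subset_iUnion_of_subset k subset_rfl)
  have hhit := h.measure_slice_hitSet_le_one hle ht hx hb hb₀
  have hhit_one : μ ({t} ×ˢ hitSet r lam lamT i b) = 1 :=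
    hhit.antisymm ((hμ.one_le hmeas hk).trans (measure_mono hsub))
  have hk_one : μ ({t} ×ˢ jumpInterval r lam lamT (pairTo i k) b) = 1 :=
    ((measure_mono hsub).trans hhit).antisymm (hμ.one_le hmeas hk)
  have h_coeff : ∀ᵐ z ∂μ, z ∈ Prod.fst ⁻¹' {t} → hCoeff r lam lamT i b z.2 =
      (jumpInterval r lam lamT (pairTo i k) b).indicator (fun _ => (k.1 : ℝ) - i) z.2 := by
    filter_upwards [measure_eq_zero_iff_ae_notMem.1 (hμ.measure_diff_eq_zero hmeas hsub hhit hk)]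
      with z hz hzt
    by_cases hzk : z.2 ∈ jumpInterval r lam lamT (pairTo i k) b
    · rw [hCoeff_of_mem hle_b hzk, indicator_of_mem hzk]
    · rw [hCoeff_of_notMem fun hz' => hz ⟨⟨hzt, hz'⟩, fun hz'' => hzk hz''.2⟩,
        indicator_of_notMem hzk]
  have hstate := h.leftLim_state_eq ht
  have hage := h.leftLim_age_eq ht
  rw [hxt, hb, setIntegral_congr_ae (measurable_fst (measurableSet_singleton t)) h_coeff,
    setIntegral_slice_indicator_const (measurableSet_jumpInterval _ b), measureReal_def, hk_one,
    ENNReal.toReal_one, one_smul] at hstate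
  simp only [hxt, hb, gCoeff_eq_indicator hle_b, smul_eq_mul, measureReal_def, hhit_one,
    setIntegral_slice_indicator_const (measurableSet_hitSet i b), ENNReal.toReal_one] at hage
  exact ⟨Subtype.ext (by linarith), by linarith⟩

lemma state_eq_of_slice_hitSet_eq_zero (h : IsSolutionPath r lam lamT μ i a x y) (ht : 0 < t)
    (hx : ∀ u ∈ Ico 0 t, x u = i) (hb : Function.leftLim y t = b)
    (h0 : μ ({t} ×ˢ hitSet r lam lamT i b) = 0) : x t = i := by
  have hstate := h.leftLim_state_eq ht
  rw [leftLim_eq_of_eqOn_const ht hx, hb, setIntegral_eq_zero_of_ae_eq_zero, sub_zero] at hstate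
  · exact Subtype.ext hstate.symm
  · filter_upwards [measure_eq_zero_iff_ae_notMem.1 h0] with z hz hzt
    exact hCoeff_of_notMem fun hz' => hz ⟨hzt, hz'⟩

lemma age_eq_add_of_const [Countable S] [IsStrictTotalOrder (Pairs S) r]
    (hle : ∀ p y, 0 ≤ y → lam p y ≤ lamT p y) (hμ : IntegerValued μ)
    (h : IsSolutionPath r lam lamT μ i a x y) (ht : 0 < t) (hx : ∀ u ∈ Icc 0 t, x u = i) :
    y t = a + t := by
  have hint := h.integrable_g t ht
  have hage := h.age_eq t ht
  simp only [prod_univ] at hint hage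
  have hslab : MeasurableSet (Prod.fst ⁻¹' Ioc 0 t : Set (ℝ × ℝ)) :=
    measurable_fst measurableSet_Ioc
  rw [h.init_age, integral_eq_zero_of_ae ((hμ.restrict hslab).ae_eq_zero_of_forall_slice hint ?_),
    sub_zero] at hage
  · exact hage
  intro u
  rw [Measure.restrict_restrict (measurable_fst (measurableSet_singleton u)),
    ae_restrict_iff' ((measurable_fst (measurableSet_singleton u)).inter hslab)]
  by_cases hu : u ∈ Ioc 0 t
  · have hxu : ∀ s ∈ Ico 0 u, x s = i := fun s hs => hx s ⟨hs.1, hs.2.le.trans hu.2⟩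
    rcases (h.leftLim_age_nonneg hu.1).eq_or_lt with hb₀ | hb₀
    · filter_upwards with z hz
      simp only [show z.1 = u from hz.1, ← hb₀, gCoeff, zero_mul]
    · have hnull : μ ({u} ×ˢ hitSet r lam lamT i (Function.leftLim y u)) = 0 := by
        rw [hitSet, prod_iUnion, measure_iUnion_null_iff]
        intro k
        by_contra hk
        exact k.2 ((h.jump_of_slice_ne_zero hle hμ hu.1 hxu rfl hb₀ hk).1.symm.trans
          (hx u ⟨hu.1.le, hu.2⟩))
      filter_upwards [measure_eq_zero_iff_ae_notMem.1 hnull] with z hz hzu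
      rw [show z.1 = u from hzu.1, leftLim_eq_of_eqOn_const hu.1 hxu,
        gCoeff_eq_indicator fun q => hle q _ hb₀.le,
        indicator_of_notMem fun hz' => hz ⟨hzu.1, hz'⟩]
  · exact ae_of_all _ fun z hz => (hu (hz.1 ▸ hz.2)).elim

lemma leftLim_age_eq_add [Countable S] [IsStrictTotalOrder (Pairs S) r]
    (hle : ∀ p y, 0 ≤ y → lam p y ≤ lamT p y) (hμ : IntegerValued μ)
    (h : IsSolutionPath r lam lamT μ i a x y) (ht : 0 < t) (hx : ∀ u ∈ Ico 0 t, x u = i) :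
    Function.leftLim y t = a + t := by
  have hlim : Tendsto (fun u => a + u) (𝓝[<] t) (𝓝 (a + t)) :=
    ((continuous_const_add a).tendsto t).mono_left nhdsWithin_le_nhds
  refine leftLim_eq_of_tendsto (hlim.congr' ?_)
  filter_upwards [Ioo_mem_nhdsLT ht] with u hu
  exact (h.age_eq_add_of_const hle hμ hu.1 fun s hs => hx s ⟨hs.1, hs.2.trans_lt hu.2⟩).symm

lemma jump_of_ageRegion_slice_ne_zero [Countable S] [IsStrictTotalOrder (Pairs S) r]
    (hle : ∀ p y, 0 ≤ y → lam p y ≤ lamT p y) (hμ : IntegerValued μ)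
    (h : IsSolutionPath r lam lamT μ i a x y) (ha : 0 ≤ a) (hx : ∀ u ∈ Ico 0 t, x u = i)
    {k : {k : S // k ≠ i}}
    (hk : μ (ageRegion (jumpInterval r lam lamT (pairTo i k)) a ∩ Prod.fst ⁻¹' {t}) ≠ 0) :
    x t = k ∧ y t = 0 := by
  have ht := pos_of_measure_ageRegion_slice_ne_zero hk
  rw [ageRegion_inter_slice ht] at hk
  exact h.jump_of_slice_ne_zero hle hμ ht hx (h.leftLim_age_eq_add hle hμ ht hx) (by positivity) hk

lemma state_eq_iff_ageRegion_slice_eq_zero [Countable S] [IsStrictTotalOrder (Pairs S) r]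
    (hle : ∀ p y, 0 ≤ y → lam p y ≤ lamT p y) (hμ : IntegerValued μ)
    (h : IsSolutionPath r lam lamT μ i a x y) (ha : 0 ≤ a) (ht : 0 < t)
    (hx : ∀ u ∈ Ico 0 t, x u = i) :
    x t = i ↔ μ (ageRegion (hitSet r lam lamT i) a ∩ Prod.fst ⁻¹' {t}) = 0 := by
  have hage := h.leftLim_age_eq_add hle hμ ht hx
  rw [ageRegion_inter_slice ht]
  refine ⟨fun hxt => ?_, h.state_eq_of_slice_hitSet_eq_zero ht hx hage⟩
  rw [hitSet, prod_iUnion, measure_iUnion_null_iff]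
  intro k
  by_contra hk
  exact k.2 ((h.jump_of_slice_ne_zero hle hμ ht hx hage (by positivity) hk).1.symm.trans hxt)

lemma const_iff_ageRegion_null [Countable S] [IsStrictTotalOrder (Pairs S) r]
    (hlam : ∀ p, Measurable (lam p)) (hlamT : ∀ p, Measurable (lamT p))
    (hle : ∀ p y, 0 ≤ y → lam p y ≤ lamT p y) (hμ : IntegerValued μ)
    (h : IsSolutionPath r lam lamT μ i a x y) (ha : 0 ≤ a)
    (hfin : ∀ t, μ (ageRegion (hitSet r lam lamT i) a ∩ Prod.fst ⁻¹' Iic t) ≠ ∞) :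
    (∀ u ∈ Ico 0 t, x u = i) ↔
      μ (ageRegion (hitSet r lam lamT i) a ∩ Prod.fst ⁻¹' Iio t) = 0 := by
  set R := ageRegion (hitSet r lam lamT i) a
  constructor
  · intro hx
    by_contra h0
    obtain ⟨T, -, hT⟩ := hμ.exists_first_slice ((measurableSet_ageRegion
      (measurableSet_mem_hitSet hlam hlamT i) a).inter (measurable_fst measurableSet_Iio)) h0
      (measure_ne_top_of_subset (inter_subset_inter_right _ (preimage_mono Iio_subset_Iic_self))
        (hfin t))
    obtain ⟨z, ⟨⟨hzR, hzt⟩, rfl⟩⟩ := nonempty_of_measure_ne_zero hT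
    refine hT (measure_mono_null (inter_subset_inter_left _ inter_subset_left) ?_)
    exact (h.state_eq_iff_ageRegion_slice_eq_zero hle hμ ha hzR.1 fun u hu =>
      hx u ⟨hu.1, hu.2.trans hzt⟩).1 (hx _ ⟨hzR.1.le, hzt⟩)
  · intro h0 u hu
    by_contra hne
    rw [← h.init_state] at hne
    obtain ⟨T, hT, hbefore, hxT⟩ := h.pure_jump.exists_first_exit hu.1 hne
    rw [h.init_state] at hbefore hxT
    refine hxT ((h.state_eq_iff_ageRegion_slice_eq_zero hle hμ ha hT.1 hbefore).2 ?_)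
    refine measure_mono_null (inter_subset_inter_right _ ?_) h0
    exact preimage_mono (singleton_subset_iff.2 (hT.2.trans_lt hu.2))

variable {j : S} {a₁ a₂ : ℝ} {x₁ x₂ : ℝ → S} {y₁ y₂ : ℝ → ℝ}

lemma meets_at_iff_of_slice_null [Countable S] [IsStrictTotalOrder (Pairs S) r]
    (hle : ∀ p y, 0 ≤ y → lam p y ≤ lamT p y) (hμ : IntegerValued μ) (hij : i ≠ j)
    (h₁ : IsSolutionPath r lam lamT μ i a₁ x₁ y₁) (h₂ : IsSolutionPath r lam lamT μ j a₂ x₂ y₂)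
    (ha₁ : 0 ≤ a₁) (ha₂ : 0 ≤ a₂) (ht : 0 < t) (hx₁ : ∀ u ∈ Ico 0 t, x₁ u = i)
    (hx₂ : ∀ u ∈ Ico 0 t, x₂ u = j)
    (h0 : μ (ageRegion (hitSet r lam lamT j) a₂ ∩ Prod.fst ⁻¹' {t}) = 0) :
    (collectiveTime x₁ x₂ 1 = t ∧ x₁ t = x₂ t ∧ min (y₁ t) (y₂ t) = 0) ↔
      μ (ageRegion (jumpInterval r lam lamT (pairTo i ⟨j, hij.symm⟩)) a₁ ∩
        Prod.fst ⁻¹' {t}) ≠ 0 := by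
  have hx₂t : x₂ t = j := (h₂.state_eq_iff_ageRegion_slice_eq_zero hle hμ ha₂ ht hx₂).2 h0
  constructor
  · rintro ⟨-, hx, -⟩ hnull
    have hx₁t : x₁ t ≠ i := by rw [hx, hx₂t]; exact hij.symm
    refine hx₁t ((h₁.state_eq_iff_ageRegion_slice_eq_zero hle hμ ha₁ ht hx₁).2 ?_)
    rw [ageRegion_inter_slice ht, hitSet, prod_iUnion, measure_iUnion_null_iff]
    intro k
    by_contra hk
    rw [← ageRegion_inter_slice ht] at hk
    have hkj : k = ⟨j, hij.symm⟩ := Subtype.ext <|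
      (h₁.jump_of_ageRegion_slice_ne_zero hle hμ ha₁ hx₁ hk).1.symm.trans (hx.trans hx₂t)
    exact hk (hkj ▸ hnull)
  · intro hne
    obtain ⟨hx₁t, hy₁t⟩ := h₁.jump_of_ageRegion_slice_ne_zero hle hμ ha₁ hx₁ hne
    refine ⟨collectiveTime_one_eq ht hx₁ hx₂ ?_, hx₁t.trans hx₂t.symm, ?_⟩
    · rw [hx₁t]; exact hij.symm
    · rw [hy₁t, min_eq_left (h₂.age_nonneg t ht.le)]

end IsSolutionPath

section MeetingRegion

variable {S : Set ℝ} {r : Pairs S → Pairs S → Prop} {lam lamT : Pairs S → ℝ → ℝ} {i j : S}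
  {a₁ a₂ : ℝ}

variable (r lam lamT) in
/-- The points at which at least one of two processes jumps, when they have states `i`, `j` and
ages `a₁`, `a₂` at time `0` and neither of them has jumped before. -/
def jumpRegion (i j : S) (a₁ a₂ : ℝ) : Set (ℝ × ℝ) :=
  ageRegion (hitSet r lam lamT i) a₁ ∪ ageRegion (hitSet r lam lamT j) a₂

variable (r lam lamT) in
/-- The points of the `jumpRegion` at which one of the processes jumps to the state of the other. -/
def meetingRegion (hij : i ≠ j) (a₁ a₂ : ℝ) : Set (ℝ × ℝ) :=
  ageRegion (jumpInterval r lam lamT (pairTo i ⟨j, hij.symm⟩)) a₁ ∪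
    ageRegion (jumpInterval r lam lamT (pairTo j ⟨i, hij⟩)) a₂

variable {μ : Measure (ℝ × ℝ)} {x₁ x₂ : ℝ → S} {y₁ y₂ : ℝ → ℝ} {t : ℝ}

lemma ageRegion_jumpInterval_subset (i : S) (k : {k : S // k ≠ i}) (a : ℝ) :
    ageRegion (jumpInterval r lam lamT (pairTo i k)) a ⊆ ageRegion (hitSet r lam lamT i) a :=
  fun _ hz => ⟨hz.1, mem_iUnion_of_mem k hz.2⟩

lemma measure_union_inter_ne_zero_iff {E : Type*} [MeasurableSpace E] {μ : Measure E}
    {A B C : Set E} (hB : μ (B ∩ C) = 0) : μ ((A ∪ B) ∩ C) ≠ 0 ↔ μ (A ∩ C) ≠ 0 := by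
  rw [union_inter_distrib_right, Ne, measure_union_null_iff, and_iff_left hB]

lemma meets_at_iff_meetingRegion_slice_ne_zero [Countable S] [IsStrictTotalOrder (Pairs S) r]
    (hle : ∀ p y, 0 ≤ y → lam p y ≤ lamT p y) (hμ : IntegerValued μ) (hij : i ≠ j)
    (h₁ : IsSolutionPath r lam lamT μ i a₁ x₁ y₁) (h₂ : IsSolutionPath r lam lamT μ j a₂ x₂ y₂)
    (ha₁ : 0 ≤ a₁) (ha₂ : 0 ≤ a₂) (ht : 0 < t) (hx₁ : ∀ u ∈ Ico 0 t, x₁ u = i)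
    (hx₂ : ∀ u ∈ Ico 0 t, x₂ u = j)
    (hsimul : μ (ageRegion (hitSet r lam lamT i) a₁ ∩ Prod.fst ⁻¹' {t}) = 0 ∨
      μ (ageRegion (hitSet r lam lamT j) a₂ ∩ Prod.fst ⁻¹' {t}) = 0) :
    (collectiveTime x₁ x₂ 1 = t ∧ x₁ t = x₂ t ∧ min (y₁ t) (y₂ t) = 0) ↔
      μ (meetingRegion r lam lamT hij a₁ a₂ ∩ Prod.fst ⁻¹' {t}) ≠ 0 := by
  rcases hsimul with h0 | h0
  · rw [collectiveTime_one_comm, eq_comm (a := x₁ t), min_comm,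
      h₂.meets_at_iff_of_slice_null hle hμ hij.symm h₁ ha₂ ha₁ ht hx₂ hx₁ h0, meetingRegion,
      union_comm, measure_union_inter_ne_zero_iff]
    exact measure_mono_null (inter_subset_inter_left _ (ageRegion_jumpInterval_subset i _ a₁)) h0
  · rw [h₁.meets_at_iff_of_slice_null hle hμ hij h₂ ha₁ ha₂ ht hx₁ hx₂ h0, meetingRegion,
      measure_union_inter_ne_zero_iff]
    exact measure_mono_null (inter_subset_inter_left _ (ageRegion_jumpInterval_subset j _ a₂)) h0

lemma meets_iff_first_point_mem_meetingRegion [Countable S] [IsStrictTotalOrder (Pairs S) r]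
    (hlam : ∀ p, Measurable (lam p)) (hlamT : ∀ p, Measurable (lamT p))
    (hle : ∀ p y, 0 ≤ y → lam p y ≤ lamT p y) (hμ : IntegerValued μ) (hij : i ≠ j)
    (h₁ : IsSolutionPath r lam lamT μ i a₁ x₁ y₁) (h₂ : IsSolutionPath r lam lamT μ j a₂ x₂ y₂)
    (ha₁ : 0 ≤ a₁) (ha₂ : 0 ≤ a₂)
    (hfin : ∀ t, μ (jumpRegion r lam lamT i j a₁ a₂ ∩ Prod.fst ⁻¹' Iic t) ≠ ∞)
    (hsimul : ∀ t, μ (ageRegion (hitSet r lam lamT i) a₁ ∩ Prod.fst ⁻¹' {t}) = 0 ∨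
      μ (ageRegion (hitSet r lam lamT j) a₂ ∩ Prod.fst ⁻¹' {t}) = 0) :
    (∃ T : ℝ, collectiveTime x₁ x₂ 1 = T ∧ x₁ T = x₂ T ∧ min (y₁ T) (y₂ T) = 0) ↔
      ∃ T, μ (jumpRegion r lam lamT i j a₁ a₂ ∩ Prod.fst ⁻¹' Iio T) = 0 ∧
        μ (meetingRegion r lam lamT hij a₁ a₂ ∩ Prod.fst ⁻¹' {T}) ≠ 0 := by
  have no_jump_iff (T : ℝ) : ((∀ u ∈ Ico 0 T, x₁ u = i) ∧ ∀ u ∈ Ico 0 T, x₂ u = j) ↔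
      μ (jumpRegion r lam lamT i j a₁ a₂ ∩ Prod.fst ⁻¹' Iio T) = 0 := by
    rw [jumpRegion, union_inter_distrib_right, measure_union_null_iff]
    exact and_congr
      (h₁.const_iff_ageRegion_null hlam hlamT hle hμ ha₁ fun t => measure_ne_top_of_subset
        (inter_subset_inter_left _ subset_union_left) (hfin t))
      (h₂.const_iff_ageRegion_null hlam hlamT hle hμ ha₂ fun t => measure_ne_top_of_subset
        (inter_subset_inter_left _ subset_union_right) (hfin t))
  refine exists_congr fun T => ⟨fun hmeet => ?_, fun ⟨hbefore, hT⟩ => ?_⟩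
  · have hT₀ : 0 < T := by
      refine (EReal.coe_nonneg.1 (hmeet.1 ▸ collectiveTime_one_nonneg x₁ x₂)).lt_of_ne ?_
      rintro rfl
      exact hij (h₁.init_state.symm.trans (hmeet.2.1.trans h₂.init_state))
    have hx₁ : ∀ u ∈ Ico 0 T, x₁ u = i := fun u hu =>
      (h₁.pure_jump.eq_of_lt_collectiveTime hu.1
        (hmeet.1 ▸ EReal.coe_lt_coe hu.2)).trans h₁.init_state
    have hx₂ : ∀ u ∈ Ico 0 T, x₂ u = j := fun u hu =>
      (h₂.pure_jump.eq_of_lt_collectiveTime hu.1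
        (collectiveTime_one_comm x₁ x₂ ▸ hmeet.1 ▸ EReal.coe_lt_coe hu.2)).trans h₂.init_state
    exact ⟨(no_jump_iff T).1 ⟨hx₁, hx₂⟩, (meets_at_iff_meetingRegion_slice_ne_zero hle hμ hij h₁ h₂
      ha₁ ha₂ hT₀ hx₁ hx₂ (hsimul T)).1 hmeet⟩
  · obtain ⟨hx₁, hx₂⟩ := (no_jump_iff T).2 hbefore
    obtain ⟨z, hz, rfl⟩ := nonempty_of_measure_ne_zero hT
    exact (meets_at_iff_meetingRegion_slice_ne_zero hle hμ hij h₁ h₂ ha₁ ha₂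
      (hz.elim And.left And.left) hx₁ hx₂ (hsimul _)).2 hT

end MeetingRegion

/-! ### Poisson random measures -/

section Poisson

variable {Ω E : Type*} [MeasurableSpace E] {N : Ω → Measure E} {ν : Measure E} {A B : Set E}

/-- The probability `e^{-ν A}` that a Poisson random measure with intensity `ν` has no point in `A`,
for `ν A < ∞`. -/
def voidProb (ν : Measure E) (A : Set E) : ℝ≥0∞ := ENNReal.ofReal (Real.exp (-(ν A).toReal))

lemma voidProb_anti (hAB : A ⊆ B) (hB : ν B ≠ ∞) : voidProb ν B ≤ voidProb ν A := by
  have := ENNReal.toReal_mono hB (measure_mono hAB)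
  unfold voidProb
  gcongr

lemma voidProb_union (hAB : Disjoint A B) (hB : MeasurableSet B) (hA_fin : ν A ≠ ∞)
    (hB_fin : ν B ≠ ∞) : voidProb ν (A ∪ B) = voidProb ν A * voidProb ν B := by
  rw [voidProb, voidProb, voidProb, measure_union hAB hB, ENNReal.toReal_add hA_fin hB_fin,
    neg_add, Real.exp_add, ENNReal.ofReal_mul (Real.exp_pos _).le]

lemma one_sub_voidProb_le : 1 - voidProb ν A ≤ ν A := by
  rcases eq_or_ne (ν A) ∞ with h | -
  · simp [h]
  · rw [voidProb, ← ENNReal.ofReal_one, ← ENNReal.ofReal_sub _ (Real.exp_pos _).le]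
    refine ENNReal.ofReal_le_of_le_toReal ?_
    linarith [Real.add_one_le_exp (-(ν A).toReal)]

lemma voidProb_mul_le (hA : ν A ≠ ∞) : voidProb ν A * ν A ≤ 1 - voidProb ν A := by
  conv_lhs => rw [← ENNReal.ofReal_toReal hA, voidProb]
  rw [voidProb, ← ENNReal.ofReal_one, ← ENNReal.ofReal_sub _ (Real.exp_pos _).le,
    ← ENNReal.ofReal_mul (Real.exp_pos _).le]
  refine ENNReal.ofReal_le_ofReal ?_
  have h := mul_le_mul_of_nonneg_left (Real.add_one_le_exp (ν A).toReal)
    (Real.exp_pos (-(ν A).toReal)).le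
  rw [← Real.exp_add, neg_add_cancel, Real.exp_zero] at h
  linarith

/-- The event that the random measure `N` has no mass in `A` and some mass in `B`. -/
def emptyThenHit (N : Ω → Measure E) (A B : Set E) : Set Ω := {ω | N ω A = 0 ∧ N ω B ≠ 0}

namespace IsPoissonRandomMeasure

variable [MeasurableSpace Ω] {P : Measure Ω}

lemma measurableSet_emptyThenHit (hN : IsPoissonRandomMeasure P N ν) (hA : MeasurableSet A)
    (hB : MeasurableSet B) : MeasurableSet (emptyThenHit N A B) :=
  (hN.measurable A hA (measurableSet_singleton 0)).inter
    (hN.measurable B hB (measurableSet_singleton 0).compl)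

lemma measure_eq_zero_eq_voidProb (hN : IsPoissonRandomMeasure P N ν) (hA : MeasurableSet A)
    (hA_fin : ν A ≠ ∞) : P {ω | N ω A = 0} = voidProb ν A := by
  have hmap : P {ω | N ω A = 0} = P.map (fun ω => N ω A) {0} :=
    (Measure.map_apply (hN.measurable A hA) (measurableSet_singleton 0)).symm
  have hpre : (fun n : ℕ => (n : ℝ≥0∞)) ⁻¹' {0} = {0} := by ext; simp
  rw [hmap, hN.poisson A hA hA_fin, Measure.map_apply (measurable_of_countable _)
    (measurableSet_singleton 0), hpre, poissonMeasure_singleton]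
  simp [voidProb, ENNReal.coe_toNNReal_eq_toReal]

lemma ae_eq_zero [IsProbabilityMeasure P] (hN : IsPoissonRandomMeasure P N ν)
    (hA : MeasurableSet A) (h0 : ν A = 0) : ∀ᵐ ω ∂P, N ω A = 0 := by
  refine (mem_ae_iff_prob_eq_one (hN.measurable A hA (measurableSet_singleton 0))).2 ?_
  exact (hN.measure_eq_zero_eq_voidProb hA (by simp [h0])).trans (by simp [voidProb, h0])

lemma ae_ne_top (hN : IsPoissonRandomMeasure P N ν) (hA : MeasurableSet A) (hA_fin : ν A ≠ ∞) :
    ∀ᵐ ω ∂P, N ω A ≠ ∞ := by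
  refine ae_of_ae_map (p := fun x => x ≠ ∞) (hN.measurable A hA).aemeasurable ?_
  rw [hN.poisson A hA hA_fin, ae_map_iff (p := fun x : ℝ≥0∞ => x ≠ ∞)
    (measurable_of_countable _).aemeasurable (measurableSet_singleton ∞).compl]
  exact ae_of_all _ ENNReal.natCast_ne_top

lemma measure_ne_zero [IsProbabilityMeasure P] (hN : IsPoissonRandomMeasure P N ν)
    (hA : MeasurableSet A) (hA_fin : ν A ≠ ∞) : P {ω | N ω A ≠ 0} = 1 - voidProb ν A := by
  rw [← hN.measure_eq_zero_eq_voidProb hA hA_fin]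
  exact prob_compl_eq_one_sub (hN.measurable A hA (measurableSet_singleton 0))

lemma measure_ne_zero_le [IsProbabilityMeasure P] (hN : IsPoissonRandomMeasure P N ν)
    (hA : MeasurableSet A) : P {ω | N ω A ≠ 0} ≤ ν A := by
  rcases eq_or_ne (ν A) ∞ with h | h
  · simp [h]
  · exact (hN.measure_ne_zero hA h).trans_le one_sub_voidProb_le

lemma indepFun (hN : IsPoissonRandomMeasure P N ν) (hA : MeasurableSet A) (hB : MeasurableSet B)
    (hAB : Disjoint A B) : IndepFun (fun ω => N ω A) (fun ω => N ω B) P := by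
  refine (hN.indep 2 ![A, B] (Fin.forall_fin_two.2 ⟨hA, hB⟩) ?_).indepFun (zero_ne_one)
  intro k l hkl
  fin_cases k <;> fin_cases l <;> simp_all [disjoint_comm]

lemma measure_ne_zero_and_ne_zero_le [IsProbabilityMeasure P] (hN : IsPoissonRandomMeasure P N ν)
    (hA : MeasurableSet A) (hB : MeasurableSet B) (hAB : Disjoint A B) :
    P {ω | N ω A ≠ 0 ∧ N ω B ≠ 0} ≤ ν A * ν B :=
  ((hN.indepFun hA hB hAB).measure_inter_preimage_eq_mul _ _ (measurableSet_singleton 0).compl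
    (measurableSet_singleton 0).compl).trans_le
    (mul_le_mul' (hN.measure_ne_zero_le hA) (hN.measure_ne_zero_le hB))

lemma measure_emptyThenHit [IsProbabilityMeasure P] (hN : IsPoissonRandomMeasure P N ν)
    (hA : MeasurableSet A) (hB : MeasurableSet B) (hAB : Disjoint A B) (hA_fin : ν A ≠ ∞)
    (hB_fin : ν B ≠ ∞) : P (emptyThenHit N A B) = voidProb ν A * (1 - voidProb ν B) := by
  rw [← hN.measure_eq_zero_eq_voidProb hA hA_fin, ← hN.measure_ne_zero hB hB_fin]
  exact (hN.indepFun hA hB hAB).measure_inter_preimage_eq_mul _ _ (measurableSet_singleton 0)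
    (measurableSet_singleton 0).compl

lemma measure_emptyThenHit_le [IsProbabilityMeasure P] (hN : IsPoissonRandomMeasure P N ν)
    (hA : MeasurableSet A) (hB : MeasurableSet B) (hAB : Disjoint A B) (hA_fin : ν A ≠ ∞)
    (hB_fin : ν B ≠ ∞) : P (emptyThenHit N A B) ≤ voidProb ν A * ν B := by
  rw [hN.measure_emptyThenHit hA hB hAB hA_fin hB_fin]
  gcongr
  exact one_sub_voidProb_le

lemma voidProb_union_mul_le_measure_emptyThenHit [IsProbabilityMeasure P]
    (hN : IsPoissonRandomMeasure P N ν) (hA : MeasurableSet A) (hB : MeasurableSet B)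
    (hAB : Disjoint A B) (hA_fin : ν A ≠ ∞) (hB_fin : ν B ≠ ∞) :
    voidProb ν (A ∪ B) * ν B ≤ P (emptyThenHit N A B) := by
  rw [hN.measure_emptyThenHit hA hB hAB hA_fin hB_fin, voidProb_union hAB hB hA_fin hB_fin,
    mul_assoc]
  gcongr
  exact voidProb_mul_le hB_fin

end IsPoissonRandomMeasure

end Poisson

/-! ### The first point of a Poisson random measure -/

section TimeCells

variable {E : Type*}

/-- The points whose time coordinate lies in the `k`-th cell of mesh `δ` of the half-line. -/
def timeCell (δ : ℝ) (k : ℕ) : Set (ℝ × E) := Prod.fst ⁻¹' Ioc (δ * k) (δ * (k + 1))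

lemma measurableSet_timeCell [MeasurableSpace E] (δ : ℝ) (k : ℕ) :
    MeasurableSet (timeCell δ k : Set (ℝ × E)) :=
  measurable_fst measurableSet_Ioc

lemma iUnion_Ioc_mesh {δ : ℝ} (hδ : 0 < δ) : ⋃ k : ℕ, Ioc (δ * k) (δ * (k + 1)) = Ioi 0 := by
  have h := iUnion_Ioc_map_succ_eq_Ioi (f := fun k : ℕ => δ * k) (fun k => by
      simp only [Nat.bot_eq_zero, CharP.cast_eq_zero, mul_zero]; positivity)
    (not_bddAbove_of_tendsto_atTop (tendsto_natCast_atTop_atTop.const_mul_atTop hδ))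
  simpa using h

lemma iUnion_timeCell {δ : ℝ} (hδ : 0 < δ) :
    ⋃ k, timeCell δ k = (Prod.fst ⁻¹' Ioi 0 : Set (ℝ × E)) := by
  simp only [timeCell, ← preimage_iUnion, iUnion_Ioc_mesh hδ]

lemma exists_slice_subset_timeCell {δ t : ℝ} (hδ : 0 < δ) (ht : 0 < t) :
    ∃ k, (Prod.fst ⁻¹' {t} : Set (ℝ × E)) ⊆ timeCell δ k := by
  obtain ⟨k, hk⟩ := mem_iUnion.1 ((iUnion_Ioc_mesh hδ).symm.subset (mem_Ioi.2 ht))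
  exact ⟨k, preimage_mono (singleton_subset_iff.2 hk)⟩

lemma pairwise_disjoint_timeCell {δ : ℝ} (hδ : 0 ≤ δ) :
    Pairwise (Function.onFun Disjoint (timeCell δ : ℕ → Set (ℝ × E))) := by
  have hmono : Monotone fun k : ℕ => δ * k := fun k l hkl => by dsimp only; gcongr
  intro k l hkl
  simpa [timeCell, Function.onFun] using
    (hmono.pairwise_disjoint_on_Ioc_succ hkl).preimage (Prod.fst (β := E))

lemma union_timeCell {δ : ℝ} (hδ : 0 ≤ δ) (k : ℕ) :
    Prod.fst ⁻¹' Iic (δ * k) ∪ timeCell δ k = (Prod.fst ⁻¹' Iic (δ * (k + 1)) : Set (ℝ × E)) := by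
  rw [timeCell, ← preimage_union, Iic_union_Ioc_eq_Iic (by gcongr; linarith)]

end TimeCells

section FirstPoint

variable {Ω E : Type*} [MeasurableSpace E] {N : Ω → Measure (ℝ × E)} {ν : Measure (ℝ × E)}
  {A B C U : Set (ℝ × E)} {c : ℝ≥0} {δ : ℝ}

/-- All points of `U` have positive time coordinates, and under the intensity `ν` they occur at a
rate of at most `c` per unit of time. -/
structure RateBounded (ν : Measure (ℝ × E)) (U : Set (ℝ × E)) (c : ℝ≥0) : Prop where
  subset_Ioi : U ⊆ Prod.fst ⁻¹' Ioi 0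
  measure_Ioc_le : ∀ s t, s ≤ t → ν (U ∩ Prod.fst ⁻¹' Ioc s t) ≤ c * ENNReal.ofReal (t - s)

/-- The probability that a Poisson random measure with intensity `ν` has no point in `U` up to
time `t`. -/
def survivalProb (ν : Measure (ℝ × E)) (U : Set (ℝ × E)) (t : ℝ) : ℝ≥0∞ :=
  voidProb ν (U ∩ Prod.fst ⁻¹' Iic t)

namespace RateBounded

lemma mono (hU : RateBounded ν U c) (hAU : A ⊆ U) : RateBounded ν A c where
  subset_Ioi := hAU.trans hU.subset_Ioi
  measure_Ioc_le s t hst :=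
    (measure_mono (inter_subset_inter_left _ hAU)).trans (hU.measure_Ioc_le s t hst)

lemma measure_Iic_ne_top (hU : RateBounded ν U c) (t : ℝ) : ν (U ∩ Prod.fst ⁻¹' Iic t) ≠ ∞ := by
  have hsub : U ∩ Prod.fst ⁻¹' Iic t ⊆ U ∩ Prod.fst ⁻¹' Ioc 0 (max 0 t) := fun z hz =>
    ⟨hz.1, hU.subset_Ioi hz.1, le_max_of_le_right hz.2⟩
  exact ne_top_of_le_ne_top (by finiteness)
    ((measure_mono hsub).trans (hU.measure_Ioc_le 0 _ (le_max_left 0 t)))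

lemma measure_timeCell_le (hU : RateBounded ν U c) (hδ : 0 ≤ δ) (k : ℕ) :
    ν (U ∩ timeCell δ k) ≤ c * ENNReal.ofReal δ := by
  have h := hU.measure_Ioc_le (δ * k) (δ * (k + 1)) (by gcongr; linarith)
  rwa [← mul_sub, add_sub_cancel_left, mul_one] at h

lemma measure_timeCell_ne_top (hU : RateBounded ν U c) (hδ : 0 ≤ δ) (k : ℕ) :
    ν (U ∩ timeCell δ k) ≠ ∞ :=
  ne_top_of_le_ne_top (by finiteness) (hU.measure_timeCell_le hδ k)

lemma survivalProb_anti (hU : RateBounded ν U c) : Antitone (survivalProb ν U) := fun _ t hst =>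
  voidProb_anti (inter_subset_inter_right _ (preimage_mono (Iic_subset_Iic.2 hst)))
    (hU.measure_Iic_ne_top t)

lemma exp_mul_survivalProb_le (hU : RateBounded ν U c) (hU_meas : MeasurableSet U) (hδ : 0 ≤ δ)
    (k : ℕ) : ENNReal.ofReal (Real.exp (-(c * δ))) * survivalProb ν U (δ * k) ≤
      survivalProb ν U (δ * (k + 1)) := by
  have hdisj : Disjoint (U ∩ Prod.fst ⁻¹' Iic (δ * k)) (U ∩ timeCell δ k) :=
    (Disjoint.preimage _ (Iic_disjoint_Ioc le_rfl)).mono inter_subset_right inter_subset_right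
  rw [survivalProb, survivalProb, ← union_timeCell hδ k, inter_union_distrib_left,
    voidProb_union hdisj (hU_meas.inter (measurableSet_timeCell δ k)) (hU.measure_Iic_ne_top _)
      (hU.measure_timeCell_ne_top hδ k), mul_comm]
  have hcell_real : (ν (U ∩ timeCell δ k)).toReal ≤ c * δ := by
    simpa [ENNReal.toReal_ofReal hδ] using
      ENNReal.toReal_mono (by finiteness) (hU.measure_timeCell_le hδ k)
  unfold voidProb
  gcongr

end RateBounded

/-- The event that `N` has no point of `U` before the `k`-th time cell and some point of `C` in this
cell. -/
def someInCell (N : Ω → Measure (ℝ × E)) (U C : Set (ℝ × E)) (δ : ℝ) (k : ℕ) : Set Ω :=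
  emptyThenHit N (U ∩ Prod.fst ⁻¹' Iic (δ * k)) (C ∩ timeCell δ k)

/-- The event that `N` has no point of `U` before the `k`-th time cell, and in this cell some point
of `C` but no other point of `U`. -/
def onlyInCell (N : Ω → Measure (ℝ × E)) (U C : Set (ℝ × E)) (δ : ℝ) (k : ℕ) : Set Ω :=
  emptyThenHit N (U ∩ Prod.fst ⁻¹' Iic (δ * k) ∪ (U \ C) ∩ timeCell δ k) (C ∩ timeCell δ k)

/-- The event that `N` has points in `U` and that a first one of them lies in `C`, where `C ⊆ U`. -/
def firstPointIn (N : Ω → Measure (ℝ × E)) (U C : Set (ℝ × E)) : Set Ω :=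
  {ω | ∃ T, N ω (U ∩ Prod.fst ⁻¹' Iio T) = 0 ∧ N ω (C ∩ Prod.fst ⁻¹' {T}) ≠ 0}

lemma firstPointIn_subset_iUnion_someInCell (hC : C ⊆ Prod.fst ⁻¹' Ioi 0) (hδ : 0 < δ) :
    firstPointIn N U C ⊆ ⋃ k, someInCell N U C δ k := by
  rintro ω ⟨T, hbefore, hT⟩
  obtain ⟨z, ⟨hzC, rfl⟩⟩ := nonempty_of_measure_ne_zero hT
  obtain ⟨k, hk⟩ := exists_slice_subset_timeCell (E := E) hδ (hC hzC)
  have hk_lt : δ * k < z.1 := (hk (mem_singleton z.1)).1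
  exact mem_iUnion.2 ⟨k,
    measure_mono_null (inter_subset_inter_right _ (preimage_mono (Iic_subset_Iio.2 hk_lt))) hbefore,
    fun h => hT (measure_mono_null (inter_subset_inter_right _ hk) h)⟩

lemma mem_firstPointIn_of_mem_onlyInCell {ω : Ω} (hω : IntegerValued (N ω)) (hC : MeasurableSet C)
    (hCU : C ⊆ U) (hfin : ∀ t, N ω (U ∩ Prod.fst ⁻¹' Iic t) ≠ ∞) {k : ℕ}
    (h : ω ∈ onlyInCell N U C δ k) : ω ∈ firstPointIn N U C := by
  obtain ⟨T, hbefore, hT⟩ := hω.exists_first_slice (hC.inter (measurableSet_timeCell δ k)) h.2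
    (measure_ne_top_of_subset (inter_subset_inter hCU (preimage_mono Ioc_subset_Iic_self))
      (hfin (δ * (k + 1))))
  refine ⟨T, measure_mono_null (fun z hz => ?_) (measure_union_null h.1 hbefore), fun h0 =>
    hT (measure_mono_null (inter_subset_inter_left _ inter_subset_left) h0)⟩
  obtain ⟨w, hw, rfl⟩ := nonempty_of_measure_ne_zero hT
  by_cases hzk : z.1 ≤ δ * k
  · exact Or.inl (Or.inl ⟨hz.1, hzk⟩)
  · have hz_cell : z ∈ timeCell δ k := ⟨not_le.1 hzk, (mem_Iio.1 hz.2).le.trans hw.2.2⟩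
    by_cases hzC : z ∈ C
    · exact Or.inr ⟨⟨hzC, hz_cell⟩, hz.2⟩
    · exact Or.inl (Or.inr ⟨⟨hz.1, hzC⟩, hz_cell⟩)

lemma pairwise_disjoint_onlyInCell (hCU : C ⊆ U) (hδ : 0 ≤ δ) :
    Pairwise (Function.onFun Disjoint (onlyInCell N U C δ)) := by
  refine (pairwise_disjoint_on _).2 fun k l hkl => Set.disjoint_left.2 fun ω hk hl => hk.2 ?_
  have hkl' : (k : ℝ) + 1 ≤ l := by exact_mod_cast hkl
  refine measure_mono_null (fun z hz => Or.inl ⟨hCU hz.1, hz.2.2.trans ?_⟩) hl.1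
  gcongr

lemma lintegral_eq_tsum_timeCell (hC : MeasurableSet C) (hC_pos : C ⊆ Prod.fst ⁻¹' Ioi 0)
    (hδ : 0 < δ) (f : ℝ × E → ℝ≥0∞) :
    ∫⁻ z in C, f z ∂ν = ∑' k, ∫⁻ z in C ∩ timeCell δ k, f z ∂ν := by
  rw [← lintegral_iUnion (fun k => hC.inter (measurableSet_timeCell δ k)) fun k l hkl =>
      (pairwise_disjoint_timeCell hδ.le hkl).mono inter_subset_right inter_subset_right,
    ← inter_iUnion, iUnion_timeCell hδ, inter_eq_left.2 hC_pos]

lemma le_of_forall_exp_mul_le {x y : ℝ≥0∞} (c : ℝ)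
    (h : ∀ n : ℕ, ENNReal.ofReal (Real.exp (-(c * (1 / ((n : ℝ) + 1))))) * x ≤ y) : x ≤ y := by
  have h_mesh : Tendsto (fun n : ℕ => -(c * (1 / ((n : ℝ) + 1)))) atTop (𝓝 0) := by
    simpa using ((tendsto_one_div_add_atTop_nhds_zero_nat (𝕜 := ℝ)).const_mul c).neg
  have h_exp := ENNReal.tendsto_ofReal ((Real.continuous_exp.tendsto 0).comp h_mesh)
  rw [Real.exp_zero, ENNReal.ofReal_one] at h_exp
  have h_lim := ENNReal.Tendsto.mul_const (b := x) h_exp (Or.inl one_ne_zero)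
  rw [one_mul] at h_lim
  exact le_of_tendsto' h_lim h

namespace IsPoissonRandomMeasure

variable [MeasurableSpace Ω] {P : Measure Ω}

lemma measurableSet_onlyInCell (hN : IsPoissonRandomMeasure P N ν) (hU : MeasurableSet U)
    (hC : MeasurableSet C) (δ : ℝ) (k : ℕ) : MeasurableSet (onlyInCell N U C δ k) :=
  hN.measurableSet_emptyThenHit ((hU.inter (measurable_fst measurableSet_Iic)).union
    ((hU.diff hC).inter (measurableSet_timeCell δ k))) (hC.inter (measurableSet_timeCell δ k))

lemma ae_measure_Iic_ne_top (hN : IsPoissonRandomMeasure P N ν) (hU : RateBounded ν U c)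
    (hU_meas : MeasurableSet U) : ∀ᵐ ω ∂P, ∀ t, N ω (U ∩ Prod.fst ⁻¹' Iic t) ≠ ∞ := by
  have hnat (n : ℕ) : ∀ᵐ ω ∂P, N ω (U ∩ Prod.fst ⁻¹' Iic (n : ℝ)) ≠ ∞ :=
    hN.ae_ne_top (hU_meas.inter (measurable_fst measurableSet_Iic)) (hU.measure_Iic_ne_top n)
  filter_upwards [ae_all_iff.2 hnat] with ω hω t
  obtain ⟨n, hn⟩ := exists_nat_ge t
  exact measure_ne_top_of_subset (inter_subset_inter_right _ (preimage_mono (Iic_subset_Iic.2 hn)))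
    (hω n)

variable [IsProbabilityMeasure P]

lemma exp_mul_measure_someInCell_le (hN : IsPoissonRandomMeasure P N ν) (hU : RateBounded ν U c)
    (hU_meas : MeasurableSet U) (hC : MeasurableSet C) (hCU : C ⊆ U) (hδ : 0 ≤ δ) (k : ℕ) :
    ENNReal.ofReal (Real.exp (-(c * δ))) * P (someInCell N U C δ k) ≤
      ∫⁻ z in C ∩ timeCell δ k, survivalProb ν U z.1 ∂ν := by
  have hcell : MeasurableSet (C ∩ timeCell δ k) := hC.inter (measurableSet_timeCell δ k)
  have hdisj : Disjoint (U ∩ Prod.fst ⁻¹' Iic (δ * k)) (C ∩ timeCell δ k) :=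
    (Disjoint.preimage _ (Iic_disjoint_Ioc le_rfl)).mono inter_subset_right inter_subset_right
  calc _ ≤ ENNReal.ofReal (Real.exp (-(c * δ))) *
        (survivalProb ν U (δ * k) * ν (C ∩ timeCell δ k)) := by
        gcongr
        exact hN.measure_emptyThenHit_le (hU_meas.inter (measurable_fst measurableSet_Iic)) hcell
          hdisj (hU.measure_Iic_ne_top _) ((hU.mono hCU).measure_timeCell_ne_top hδ k)
    _ ≤ survivalProb ν U (δ * (k + 1)) * ν (C ∩ timeCell δ k) := by
        rw [← mul_assoc]
        gcongr
        exact hU.exp_mul_survivalProb_le hU_meas hδ k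
    _ = ∫⁻ z in C ∩ timeCell δ k, survivalProb ν U (δ * (k + 1)) ∂ν := (setLIntegral_const _ _).symm
    _ ≤ _ := setLIntegral_mono' hcell fun _ hz => hU.survivalProb_anti hz.2.2

lemma exp_mul_lintegral_le_measure_onlyInCell (hN : IsPoissonRandomMeasure P N ν)
    (hU : RateBounded ν U c) (hU_meas : MeasurableSet U) (hC : MeasurableSet C) (hCU : C ⊆ U)
    (hδ : 0 ≤ δ) (k : ℕ) :
    ENNReal.ofReal (Real.exp (-(c * δ))) * ∫⁻ z in C ∩ timeCell δ k, survivalProb ν U z.1 ∂ν ≤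
      P (onlyInCell N U C δ k) := by
  have hcell : MeasurableSet (C ∩ timeCell δ k) := hC.inter (measurableSet_timeCell δ k)
  set V := U ∩ Prod.fst ⁻¹' Iic (δ * k) ∪ (U \ C) ∩ timeCell δ k with hV
  have hV_meas : MeasurableSet V := (hU_meas.inter (measurable_fst measurableSet_Iic)).union
    ((hU_meas.diff hC).inter (measurableSet_timeCell δ k))
  have hV_union : V ∪ C ∩ timeCell δ k = U ∩ Prod.fst ⁻¹' Iic (δ * (k + 1)) := by
    rw [hV, union_assoc, ← union_inter_distrib_right, sdiff_union_of_subset hCU,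
      ← inter_union_distrib_left, union_timeCell hδ]
  have hdisj : Disjoint V (C ∩ timeCell δ k) := disjoint_union_left.2
    ⟨(Disjoint.preimage _ (Iic_disjoint_Ioc le_rfl)).mono inter_subset_right inter_subset_right,
      disjoint_sdiff_left.mono inter_subset_left inter_subset_left⟩
  calc _ ≤ ENNReal.ofReal (Real.exp (-(c * δ))) *
        ∫⁻ _ in C ∩ timeCell δ k, survivalProb ν U (δ * k) ∂ν :=
        mul_le_mul' le_rfl (setLIntegral_mono' hcell fun _ hz => hU.survivalProb_anti hz.2.1.le)
    _ ≤ survivalProb ν U (δ * (k + 1)) * ν (C ∩ timeCell δ k) := by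
        rw [setLIntegral_const, ← mul_assoc]
        gcongr
        exact hU.exp_mul_survivalProb_le hU_meas hδ k
    _ = voidProb ν (V ∪ C ∩ timeCell δ k) * ν (C ∩ timeCell δ k) := by rw [hV_union, survivalProb]
    _ ≤ _ := hN.voidProb_union_mul_le_measure_emptyThenHit hV_meas hcell hdisj
        (measure_ne_top_of_subset (hV_union ▸ subset_union_left) (hU.measure_Iic_ne_top _))
        ((hU.mono hCU).measure_timeCell_ne_top hδ k)

lemma exp_mul_measure_firstPointIn_le (hN : IsPoissonRandomMeasure P N ν) (hU : RateBounded ν U c)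
    (hU_meas : MeasurableSet U) (hC : MeasurableSet C) (hCU : C ⊆ U) (hδ : 0 < δ) :
    ENNReal.ofReal (Real.exp (-(c * δ))) * P (firstPointIn N U C) ≤
      ∫⁻ z in C, survivalProb ν U z.1 ∂ν :=
  calc _ ≤ ENNReal.ofReal (Real.exp (-(c * δ))) * ∑' k, P (someInCell N U C δ k) := by
        gcongr
        exact (measure_mono (firstPointIn_subset_iUnion_someInCell (hCU.trans hU.subset_Ioi)
          hδ)).trans (measure_iUnion_le _)
    _ ≤ ∑' k, ∫⁻ z in C ∩ timeCell δ k, survivalProb ν U z.1 ∂ν := by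
        rw [← ENNReal.tsum_mul_left]
        exact ENNReal.tsum_le_tsum (hN.exp_mul_measure_someInCell_le hU hU_meas hC hCU hδ.le)
    _ = _ := (lintegral_eq_tsum_timeCell hC (hCU.trans hU.subset_Ioi) hδ _).symm

lemma exp_mul_lintegral_le_measure_iUnion_onlyInCell (hN : IsPoissonRandomMeasure P N ν)
    (hU : RateBounded ν U c) (hU_meas : MeasurableSet U) (hC : MeasurableSet C) (hCU : C ⊆ U)
    (hδ : 0 < δ) :
    ENNReal.ofReal (Real.exp (-(c * δ))) * ∫⁻ z in C, survivalProb ν U z.1 ∂ν ≤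
      P (⋃ k, onlyInCell N U C δ k) := by
  rw [measure_iUnion (pairwise_disjoint_onlyInCell hCU hδ.le)
      fun k => hN.measurableSet_onlyInCell hU_meas hC δ k,
    lintegral_eq_tsum_timeCell hC (hCU.trans hU.subset_Ioi) hδ, ← ENNReal.tsum_mul_left]
  exact ENNReal.tsum_le_tsum (hN.exp_mul_lintegral_le_measure_onlyInCell hU hU_meas hC hCU hδ.le)

theorem nullMeasurableSet_and_measure_firstPointIn (hN : IsPoissonRandomMeasure P N ν)
    (hU : RateBounded ν U c) (hU_meas : MeasurableSet U) (hC : MeasurableSet C) (hCU : C ⊆ U) :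
    NullMeasurableSet (firstPointIn N U C) P ∧
      P (firstPointIn N U C) = ∫⁻ z in C, survivalProb ν U z.1 ∂ν := by
  have hmesh (n : ℕ) : (0 : ℝ) < 1 / (n + 1) := by positivity
  set L : Set Ω := ⋃ n : ℕ, ⋃ k, onlyInCell N U C (1 / (n + 1)) k
  have hL : MeasurableSet L := MeasurableSet.iUnion fun n => MeasurableSet.iUnion fun k =>
    hN.measurableSet_onlyInCell hU_meas hC _ k
  have h_lower : ∫⁻ z in C, survivalProb ν U z.1 ∂ν ≤ P L := le_of_forall_exp_mul_le c fun n =>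
    (hN.exp_mul_lintegral_le_measure_iUnion_onlyInCell hU hU_meas hC hCU (hmesh n)).trans
      (measure_mono (subset_iUnion_of_subset n subset_rfl))
  have h_upper : P (firstPointIn N U C) ≤ ∫⁻ z in C, survivalProb ν U z.1 ∂ν :=
    le_of_forall_exp_mul_le c fun n =>
      hN.exp_mul_measure_firstPointIn_le hU hU_meas hC hCU (hmesh n)
  have h_sub : L ≤ᵐ[P] firstPointIn N U C := by
    filter_upwards [hN.integer_valued, hN.ae_measure_Iic_ne_top hU hU_meas] with ω hω hfin hωL
    obtain ⟨n, hn⟩ := mem_iUnion.1 hωL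
    obtain ⟨k, hk⟩ := mem_iUnion.1 hn
    exact mem_firstPointIn_of_mem_onlyInCell hω hC hCU hfin hk
  have h_eq : L =ᵐ[P] firstPointIn N U C := ae_eq_of_ae_subset_of_measure_ge h_sub
    (h_upper.trans h_lower) hL.nullMeasurableSet (measure_ne_top P _)
  exact ⟨hL.nullMeasurableSet.congr h_eq,
    h_upper.antisymm (h_lower.trans (measure_congr h_eq).le)⟩

lemma measure_exists_slice_ne_zero_le (hN : IsPoissonRandomMeasure P N ν) (hA : RateBounded ν A c)
    (hA_meas : MeasurableSet A) (hB : MeasurableSet B) (hAB : Disjoint A B) (hδ : 0 < δ) :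
    P {ω | ∃ t, N ω (A ∩ Prod.fst ⁻¹' {t}) ≠ 0 ∧ N ω (B ∩ Prod.fst ⁻¹' {t}) ≠ 0} ≤
      c * ENNReal.ofReal δ * ν B := by
  set inCell : ℕ → Set Ω := fun k =>
    {ω | N ω (A ∩ timeCell δ k) ≠ 0 ∧ N ω (B ∩ timeCell δ k) ≠ 0}
  have h_sub : {ω | ∃ t, N ω (A ∩ Prod.fst ⁻¹' {t}) ≠ 0 ∧ N ω (B ∩ Prod.fst ⁻¹' {t}) ≠ 0} ⊆
      ⋃ k, inCell k := by
    rintro ω ⟨t, htA, htB⟩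
    obtain ⟨z, ⟨hzA, rfl⟩⟩ := nonempty_of_measure_ne_zero htA
    obtain ⟨k, hk⟩ := exists_slice_subset_timeCell (E := E) hδ (hA.subset_Ioi hzA)
    exact mem_iUnion.2 ⟨k, fun h => htA (measure_mono_null (inter_subset_inter_right _ hk) h),
      fun h => htB (measure_mono_null (inter_subset_inter_right _ hk) h)⟩
  have h_cell (k : ℕ) : P (inCell k) ≤ c * ENNReal.ofReal δ * ν (B ∩ timeCell δ k) :=
    (hN.measure_ne_zero_and_ne_zero_le (hA_meas.inter (measurableSet_timeCell δ k))
      (hB.inter (measurableSet_timeCell δ k)) (hAB.mono inter_subset_left inter_subset_left)).trans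
      (mul_le_mul_left (hA.measure_timeCell_le hδ.le k) _)
  calc _ ≤ ∑' k, P (inCell k) := (measure_mono h_sub).trans (measure_iUnion_le _)
    _ ≤ ∑' k, c * ENNReal.ofReal δ * ν (B ∩ timeCell δ k) := ENNReal.tsum_le_tsum h_cell
    _ = c * ENNReal.ofReal δ * ν (⋃ k, B ∩ timeCell δ k) := by
        rw [ENNReal.tsum_mul_left, measure_iUnion (fun k l hkl =>
          (pairwise_disjoint_timeCell hδ.le hkl).mono inter_subset_right inter_subset_right)
          fun k => hB.inter (measurableSet_timeCell δ k)]
    _ ≤ c * ENNReal.ofReal δ * ν B := by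
        gcongr
        exact iUnion_subset fun k => inter_subset_left

lemma ae_forall_slice_eq_zero_or_of_ne_top (hN : IsPoissonRandomMeasure P N ν)
    (hA : RateBounded ν A c) (hA_meas : MeasurableSet A) (hB : MeasurableSet B)
    (hAB : Disjoint A B) (hB_fin : ν B ≠ ∞) :
    ∀ᵐ ω ∂P, ∀ t, N ω (A ∩ Prod.fst ⁻¹' {t}) = 0 ∨ N ω (B ∩ Prod.fst ⁻¹' {t}) = 0 := by
  have h_lim : Tendsto (fun δ => c * ENNReal.ofReal δ * ν B) (𝓝[>] 0) (𝓝 0) := by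
    have h := (ENNReal.continuous_ofReal.tendsto 0).mono_left
      (nhdsWithin_le_nhds : 𝓝[>] (0 : ℝ) ≤ 𝓝 0)
    simpa using ENNReal.Tendsto.mul_const
      (ENNReal.Tendsto.const_mul h (Or.inr ENNReal.coe_ne_top)) (Or.inr hB_fin)
  have h_null := le_zero_iff.1 (ge_of_tendsto h_lim (eventually_mem_nhdsWithin.mono fun δ hδ =>
    hN.measure_exists_slice_ne_zero_le hA hA_meas hB hAB hδ))
  filter_upwards [measure_eq_zero_iff_ae_notMem.1 h_null] with ω hω t
  by_contra! h
  exact hω ⟨t, h⟩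

lemma ae_forall_slice_eq_zero_or (hN : IsPoissonRandomMeasure P N ν) (hA : RateBounded ν A c)
    (hB : RateBounded ν B c) (hA_meas : MeasurableSet A) (hB_meas : MeasurableSet B)
    (hAB : Disjoint A B) :
    ∀ᵐ ω ∂P, ∀ t, N ω (A ∩ Prod.fst ⁻¹' {t}) = 0 ∨ N ω (B ∩ Prod.fst ⁻¹' {t}) = 0 := by
  have hnat (n : ℕ) := hN.ae_forall_slice_eq_zero_or_of_ne_top hA hA_meas
    (hB_meas.inter (measurable_fst measurableSet_Iic))
    (hAB.mono_right inter_subset_left) (hB.measure_Iic_ne_top n)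
  filter_upwards [ae_all_iff.2 hnat] with ω hω t
  obtain ⟨n, hn⟩ := exists_nat_ge t
  refine (hω n t).imp_right fun h => measure_mono_null (fun z hz => ?_) h
  exact ⟨⟨hz.1, (show z.1 = t from hz.2).trans_le hn⟩, hz.2⟩

lemma ae_forall_slice_eq_zero_or_of_aedisjoint (hN : IsPoissonRandomMeasure P N ν)
    (hA : RateBounded ν A c) (hB : RateBounded ν B c) (hA_meas : MeasurableSet A)
    (hB_meas : MeasurableSet B) (hAB : AEDisjoint ν A B) :
    ∀ᵐ ω ∂P, ∀ t, N ω (A ∩ Prod.fst ⁻¹' {t}) = 0 ∨ N ω (B ∩ Prod.fst ⁻¹' {t}) = 0 := by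
  filter_upwards [hN.ae_eq_zero (hA_meas.inter hB_meas) hAB, hN.ae_forall_slice_eq_zero_or hA
    (hB.mono sdiff_subset) hA_meas (hB_meas.diff hA_meas) disjoint_sdiff_right] with ω h_inter h t
  refine (h t).imp_right fun h_diff => measure_mono_null (fun z hz => ?_)
    (measure_union_null h_inter h_diff)
  by_cases hzA : z ∈ A
  · exact Or.inl ⟨hzA, hz.1⟩
  · exact Or.inr ⟨⟨hz.1, hzA⟩, hz.2⟩

end IsPoissonRandomMeasure

end FirstPoint

section ProductIntensity

instance : SFinite halfLine := inferInstanceAs (SFinite (volume.restrict (Ici (0 : ℝ))))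

variable {Ω E : Type*} [MeasurableSpace E] {η : Measure E} [SFinite η] {U C : Set (ℝ × E)}
  {c : ℝ≥0} {t : ℝ}

lemma setLIntegral_prod_comp_fst {μ : Measure ℝ} [SFinite μ] {f : ℝ → ℝ≥0∞} (hf : Measurable f)
    (hC : MeasurableSet C) :
    ∫⁻ z in C, f z.1 ∂μ.prod η = ∫⁻ u, f u * η (Prod.mk u ⁻¹' C) ∂μ := by
  have hf_C : Measurable (C.indicator fun z => f z.1) := (hf.comp measurable_fst).indicator hC
  rw [← lintegral_indicator hC, lintegral_prod _ hf_C.aemeasurable]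
  refine lintegral_congr fun u => ?_
  rw [← lintegral_indicator_const (measurable_prodMk_left hC)]
  rfl

lemma prod_inter_preimage_fst {μ : Measure ℝ} [SFinite μ] (hU : MeasurableSet U)
    (I : Set ℝ) : μ.prod η (U ∩ Prod.fst ⁻¹' I) = ∫⁻ u in I, η (Prod.mk u ⁻¹' U) ∂μ := by
  rw [← Measure.restrict_apply hU, ← prod_univ, ← Measure.prod_restrict, Measure.restrict_univ,
    Measure.prod_apply hU]

lemma halfLine_restrict_Iic : halfLine.restrict (Iic t) = volume.restrict (Ioc 0 t) := by
  rw [halfLine, Measure.restrict_restrict measurableSet_Iic, Iic_inter_Ici]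
  exact Measure.restrict_congr_set Ioc_ae_eq_Icc.symm

lemma halfLine_eq_restrict_Ioi : halfLine = volume.restrict (Ioi 0) :=
  Measure.restrict_congr_set Ioi_ae_eq_Ici.symm

lemma rateBounded_halfLine_prod (hU : MeasurableSet U) (hU_pos : U ⊆ Prod.fst ⁻¹' Ioi 0)
    (hc : ∀ᵐ u ∂halfLine, η (Prod.mk u ⁻¹' U) ≤ c) : RateBounded (halfLine.prod η) U c where
  subset_Ioi := hU_pos
  measure_Ioc_le s t _ :=
    calc halfLine.prod η (U ∩ Prod.fst ⁻¹' Ioc s t)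
        = ∫⁻ u in Ioc s t, η (Prod.mk u ⁻¹' U) ∂halfLine :=
          prod_inter_preimage_fst hU _
      _ ≤ ∫⁻ _ in Ioc s t, c ∂halfLine := lintegral_mono_ae (ae_restrict_of_ae hc)
      _ = c * halfLine (Ioc s t) := setLIntegral_const _ _
      _ ≤ c * ENNReal.ofReal (t - s) := by
          rw [← Real.volume_Ioc]
          gcongr
          exact Measure.restrict_le_self

lemma survivalProb_halfLine_prod (hU : MeasurableSet U)
    (hc : ∀ᵐ u ∂halfLine, η (Prod.mk u ⁻¹' U) ≤ c) (ht : 0 ≤ t) :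
    survivalProb (halfLine.prod η) U t =
      ENNReal.ofReal (Real.exp (-∫ u in (0 : ℝ)..t, η.real (Prod.mk u ⁻¹' U))) := by
  have h_finite : ∀ᵐ u ∂volume.restrict (Ioc 0 t), η (Prod.mk u ⁻¹' U) < ∞ := by
    rw [← halfLine_restrict_Iic]
    exact ae_restrict_of_ae (hc.mono fun u hu => hu.trans_lt ENNReal.coe_lt_top)
  rw [survivalProb, voidProb, prod_inter_preimage_fst hU,
    halfLine_restrict_Iic, intervalIntegral.integral_of_le ht,
    ← integral_toReal (measurable_measure_prodMk_left hU).aemeasurable h_finite]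
  rfl

theorem IsPoissonRandomMeasure.measureReal_firstPointIn [MeasurableSpace Ω] {P : Measure Ω}
    [IsProbabilityMeasure P] {N : Ω → Measure (ℝ × E)}
    (hN : IsPoissonRandomMeasure P N (halfLine.prod η)) (hU : MeasurableSet U)
    (hC : MeasurableSet C) (hCU : C ⊆ U) (hU_pos : U ⊆ Prod.fst ⁻¹' Ioi 0)
    (hc : ∀ᵐ u ∂halfLine, η (Prod.mk u ⁻¹' U) ≤ c) :
    NullMeasurableSet (firstPointIn N U C) P ∧
    IntegrableOn (fun u => Real.exp (-∫ t in (0 : ℝ)..u, η.real (Prod.mk t ⁻¹' U)) *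
      η.real (Prod.mk u ⁻¹' C)) (Ioi 0) ∧
    P.real (firstPointIn N U C) = ∫ u in Ioi (0 : ℝ),
      Real.exp (-∫ t in (0 : ℝ)..u, η.real (Prod.mk t ⁻¹' U)) * η.real (Prod.mk u ⁻¹' C) := by
  have hU_rate := rateBounded_halfLine_prod hU hU_pos hc
  obtain ⟨h_null, h_meas⟩ :=
    hN.nullMeasurableSet_and_measure_firstPointIn hU_rate hU hC hCU
  set G : ℝ → ℝ≥0∞ := fun u => survivalProb (halfLine.prod η) U u * η (Prod.mk u ⁻¹' C)
  have hG : Measurable G :=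
    hU_rate.survivalProb_anti.measurable.mul (measurable_measure_prodMk_left hC)
  have hG_lintegral : P (firstPointIn N U C) = ∫⁻ u in Ioi 0, G u := by
    rw [h_meas, ← halfLine_eq_restrict_Ioi]
    exact setLIntegral_prod_comp_fst hU_rate.survivalProb_anti.measurable hC
  have hG_ne_top : ∫⁻ u in Ioi 0, G u ≠ ∞ := hG_lintegral ▸ measure_ne_top P _
  have hG_toReal : EqOn (fun u => (G u).toReal) (fun u =>
      Real.exp (-∫ t in (0 : ℝ)..u, η.real (Prod.mk t ⁻¹' U)) * η.real (Prod.mk u ⁻¹' C))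
      (Ioi 0) := fun u hu => by
    simp only [G, ENNReal.toReal_mul, survivalProb_halfLine_prod hU hc (mem_Ioi.1 hu).le,
      ENNReal.toReal_ofReal (Real.exp_pos _).le, measureReal_def]
  refine ⟨h_null, (integrable_toReal_of_lintegral_ne_top hG.aemeasurable hG_ne_top).congr
    (ae_restrict_of_forall_mem measurableSet_Ioi hG_toReal), ?_⟩
  rw [← setIntegral_congr_fun measurableSet_Ioi hG_toReal,
    integral_toReal hG.aemeasurable (ae_lt_top hG hG_ne_top), ← hG_lintegral, measureReal_def]

end ProductIntensity

/-! ### Intensities of the jump and meeting regions -/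

section Intensity

variable {S : Set ℝ} {r : Pairs S → Pairs S → Prop} {lam lamT : Pairs S → ℝ → ℝ}
  {c : Pairs S → ℝ} {i j : S} {a₁ a₂ y y' : ℝ}

/-- Measurable rates `lam` with spacings `lamT` that are almost everywhere equal to summable
constants `c`; under (A1) and (A3) these are the constants `‖λ_p‖_∞`. -/
structure HasConstantSpacing (lam lamT : Pairs S → ℝ → ℝ) (c : Pairs S → ℝ) : Prop where
  measurable_rate : ∀ p, Measurable (lam p)
  measurable_spacing : ∀ p, Measurable (lamT p)
  rate_nonneg : ∀ p y, 0 ≤ y → 0 ≤ lam p y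
  rate_le : ∀ p y, 0 ≤ y → lam p y ≤ lamT p y
  spacing_ae_eq : ∀ p, ∀ᵐ y ∂halfLine, lamT p y = c p
  summable : Summable c

lemma IsRateMatrix.hasConstantSpacing (hlam : IsRateMatrix lam) (hlamT : IsSpacing lam lamT)
    (hA3 : AssumptionA3 lam lamT) : HasConstantSpacing lam lamT fun p => supNorm (lam p) where
  measurable_rate := hlam.measurable
  measurable_spacing := hlamT.measurable
  rate_nonneg p y hy := (hlam.pos p y hy).le
  rate_le := hlamT.le
  spacing_ae_eq := hA3
  summable := hlam.summable_norm

variable (lam lamT c) in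
/-- The ages at which all the spacings take their constant values and dominate the rates. -/
def genericAges : Set ℝ := {y | ∀ p, 0 ≤ lam p y ∧ lam p y ≤ lamT p y ∧ lamT p y = c p}

lemma HasConstantSpacing.ae_add_mem_genericAges [Countable S] (h : HasConstantSpacing lam lamT c)
    {a : ℝ} (ha : 0 ≤ a) : ∀ᵐ u ∂halfLine, a + u ∈ genericAges lam lamT c := by
  have h_generic : ∀ᵐ y : ℝ, 0 ≤ y → ∀ p, lamT p y = c p :=
    (ae_restrict_iff' measurableSet_Ici).1 (ae_all_iff.2 h.spacing_ae_eq)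
  have h_shift := (measurePreserving_add_left volume a).quasiMeasurePreserving.ae h_generic
  refine (ae_restrict_iff' measurableSet_Ici).2 (h_shift.mono fun u hu hu₀ p => ?_)
  have hau : 0 ≤ a + u := add_nonneg ha hu₀
  exact ⟨h.rate_nonneg p _ hau, h.rate_le p _ hau, hu hau p⟩

lemma leftEnd_ne_top (hc : Summable c) (hy : y ∈ genericAges lam lamT c) (p : Pairs S) :
    leftEnd r lamT p y ≠ ∞ := by
  simp only [leftEnd, (hy _).2.2]
  exact (hc.comp_injective Subtype.val_injective).tsum_ofReal_ne_top

lemma jumpInterval_eq_Ico {p : Pairs S} (hp : 0 ≤ lam p y) (hfin : leftEnd r lamT p y ≠ ∞) :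
    jumpInterval r lam lamT p y =
      Ico (leftEnd r lamT p y).toReal ((leftEnd r lamT p y).toReal + lam p y) := by
  set L := (leftEnd r lamT p y).toReal
  have hL : leftEnd r lamT p y = ENNReal.ofReal L := (ENNReal.ofReal_toReal hfin).symm
  have hL₀ : 0 ≤ L := ENNReal.toReal_nonneg
  ext v
  by_cases hv : 0 ≤ v
  · simp only [jumpInterval, hL, mem_ofPred_eq, hv, true_and, mem_Ico]
    rw [← ENNReal.ofReal_add hL₀ hp, ENNReal.ofReal_le_ofReal_iff hv,
      ENNReal.ofReal_lt_ofReal_iff_of_nonneg hv]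
  · exact iff_of_false (fun h => hv h.1) fun h => hv (hL₀.trans h.1)

lemma volume_jumpInterval (hc : Summable c) (hy : y ∈ genericAges lam lamT c) (p : Pairs S) :
    volume (jumpInterval r lam lamT p y) = ENNReal.ofReal (lam p y) := by
  rw [jumpInterval_eq_Ico (hy p).1 (leftEnd_ne_top hc hy p), Real.volume_Ico, add_sub_cancel_left]

lemma disjoint_jumpInterval_of_mem_genericAges [IsStrictTotalOrder (Pairs S) r]
    (hy : y ∈ genericAges lam lamT c) (hy' : y' ∈ genericAges lam lamT c) {p q : Pairs S}
    (hpq : p ≠ q) : Disjoint (jumpInterval r lam lamT p y) (jumpInterval r lam lamT q y') :=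
  disjoint_jumpInterval (fun s => (hy s).2.1) (fun s => (hy' s).2.1)
    (fun s => (hy s).2.2.trans (hy' s).2.2.symm) hpq

lemma disjoint_hitSet [IsStrictTotalOrder (Pairs S) r] (hy : y ∈ genericAges lam lamT c)
    (hy' : y' ∈ genericAges lam lamT c) (hij : i ≠ j) :
    Disjoint (hitSet r lam lamT i y) (hitSet r lam lamT j y') := by
  refine disjoint_iUnion_left.2 fun k => disjoint_iUnion_right.2 fun l =>
    disjoint_jumpInterval_of_mem_genericAges hy hy' fun h => hij ?_
  exact congr_arg (fun p : Pairs S => p.1.1) h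

lemma volume_hitSet [Countable S] [IsStrictTotalOrder (Pairs S) r] (hc : Summable c)
    (hy : y ∈ genericAges lam lamT c) (i : S) :
    volume (hitSet r lam lamT i y) = ∑' k, ENNReal.ofReal (lam (pairTo i k) y) := by
  rw [hitSet, measure_iUnion (fun k l hkl => disjoint_jumpInterval_of_mem_genericAges hy hy
    ((pairTo_injective i).ne hkl)) fun _ => measurableSet_jumpInterval _ _]
  simp only [volume_jumpInterval hc hy]

lemma volume_hitSet_le [Countable S] [IsStrictTotalOrder (Pairs S) r] (hc : Summable c)
    (hy : y ∈ genericAges lam lamT c) (i : S) :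
    volume (hitSet r lam lamT i y) ≤ ∑' p, ENNReal.ofReal (c p) :=
  calc volume (hitSet r lam lamT i y) = ∑' k, ENNReal.ofReal (lam (pairTo i k) y) :=
        volume_hitSet hc hy i
    _ ≤ ∑' k, ENNReal.ofReal (c (pairTo i k)) := ENNReal.tsum_le_tsum fun _ =>
        ENNReal.ofReal_le_ofReal ((hy _).2.1.trans_eq (hy _).2.2)
    _ ≤ ∑' p, ENNReal.ofReal (c p) :=
        ENNReal.tsum_comp_le_tsum_of_injective (pairTo_injective i) _

lemma measureReal_hitSet [Countable S] [IsStrictTotalOrder (Pairs S) r] (hc : Summable c)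
    (hy : y ∈ genericAges lam lamT c) (i : S) :
    volume.real (hitSet r lam lamT i y) = exitRate lam i y := by
  rw [measureReal_def, volume_hitSet hc hy, ENNReal.tsum_toReal_eq fun _ => ENNReal.ofReal_ne_top]
  simp only [ENNReal.toReal_ofReal (hy _).1, exitRate]

lemma prodMk_preimage_ageRegion {A : ℝ → Set ℝ} {a u : ℝ} (hu : 0 < u) :
    Prod.mk u ⁻¹' ageRegion A a = A (a + u) := by
  ext v
  exact and_iff_right hu

lemma measureReal_jumpRegion_slice [Countable S] [IsStrictTotalOrder (Pairs S) r]
    (hc : Summable c) (hij : i ≠ j) {u : ℝ} (hu : 0 < u)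
    (h₁ : a₁ + u ∈ genericAges lam lamT c) (h₂ : a₂ + u ∈ genericAges lam lamT c) :
    volume.real (Prod.mk u ⁻¹' jumpRegion r lam lamT i j a₁ a₂) =
      exitRate lam i (a₁ + u) + exitRate lam j (a₂ + u) := by
  have hfin {y : ℝ} (hy : y ∈ genericAges lam lamT c) (k : S) :
      volume (hitSet r lam lamT k y) ≠ ∞ :=
    ne_top_of_le_ne_top hc.tsum_ofReal_ne_top (volume_hitSet_le hc hy k)
  rw [jumpRegion, preimage_union, prodMk_preimage_ageRegion hu, prodMk_preimage_ageRegion hu,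
    measureReal_union (disjoint_hitSet h₁ h₂ hij) (measurableSet_hitSet j _) (hfin h₁ i)
      (hfin h₂ j), measureReal_hitSet hc h₁, measureReal_hitSet hc h₂]

lemma measureReal_meetingRegion_slice [IsStrictTotalOrder (Pairs S) r]
    (hc : Summable c) (hij : i ≠ j) {u : ℝ} (hu : 0 < u)
    (h₁ : a₁ + u ∈ genericAges lam lamT c) (h₂ : a₂ + u ∈ genericAges lam lamT c) :
    volume.real (Prod.mk u ⁻¹' meetingRegion r lam lamT hij a₁ a₂) =
      lam ⟨(i, j), hij⟩ (a₁ + u) + lam ⟨(j, i), hij.symm⟩ (a₂ + u) := by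
  have hreal {y : ℝ} (hy : y ∈ genericAges lam lamT c) (p : Pairs S) :
      volume.real (jumpInterval r lam lamT p y) = lam p y := by
    rw [measureReal_def, volume_jumpInterval hc hy, ENNReal.toReal_ofReal (hy p).1]
  have hfin {y : ℝ} (hy : y ∈ genericAges lam lamT c) (p : Pairs S) :
      volume (jumpInterval r lam lamT p y) ≠ ∞ :=
    volume_jumpInterval hc hy p ▸ ENNReal.ofReal_ne_top
  have hne : pairTo i ⟨j, hij.symm⟩ ≠ pairTo j ⟨i, hij⟩ := fun h =>
    hij (congr_arg (fun p : Pairs S => p.1.1) h)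
  rw [meetingRegion, preimage_union, prodMk_preimage_ageRegion hu, prodMk_preimage_ageRegion hu,
    measureReal_union (disjoint_jumpInterval_of_mem_genericAges h₁ h₂ hne)
      (measurableSet_jumpInterval _ _) (hfin h₁ _) (hfin h₂ _), hreal h₁, hreal h₂]
  rfl

lemma measurableSet_jumpRegion [Countable S] (hlam : ∀ p, Measurable (lam p))
    (hlamT : ∀ p, Measurable (lamT p)) : MeasurableSet (jumpRegion r lam lamT i j a₁ a₂) :=
  (measurableSet_ageRegion (measurableSet_mem_hitSet hlam hlamT i) a₁).union
    (measurableSet_ageRegion (measurableSet_mem_hitSet hlam hlamT j) a₂)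

lemma measurableSet_meetingRegion [Countable S] (hlam : ∀ p, Measurable (lam p))
    (hlamT : ∀ p, Measurable (lamT p)) (hij : i ≠ j) :
    MeasurableSet (meetingRegion r lam lamT hij a₁ a₂) :=
  (measurableSet_ageRegion (measurableSet_mem_jumpInterval hlam hlamT _) a₁).union
    (measurableSet_ageRegion (measurableSet_mem_jumpInterval hlam hlamT _) a₂)

lemma meetingRegion_subset_jumpRegion (hij : i ≠ j) :
    meetingRegion r lam lamT hij a₁ a₂ ⊆ jumpRegion r lam lamT i j a₁ a₂ :=
  union_subset_union (ageRegion_jumpInterval_subset _ _ _) (ageRegion_jumpInterval_subset _ _ _)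

lemma jumpRegion_subset_Ioi : jumpRegion r lam lamT i j a₁ a₂ ⊆ Prod.fst ⁻¹' Ioi 0 :=
  union_subset (fun _ hz => hz.1) fun _ hz => hz.1

namespace HasConstantSpacing

lemma ae_generic [Countable S] (h : HasConstantSpacing lam lamT c) (ha₁ : 0 ≤ a₁)
    (ha₂ : 0 ≤ a₂) : ∀ᵐ u ∂volume.restrict (Ioi 0), 0 < u ∧
      a₁ + u ∈ genericAges lam lamT c ∧ a₂ + u ∈ genericAges lam lamT c := by
  have h₁ := h.ae_add_mem_genericAges ha₁
  have h₂ := h.ae_add_mem_genericAges ha₂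
  rw [halfLine_eq_restrict_Ioi] at h₁ h₂
  filter_upwards [ae_restrict_mem measurableSet_Ioi, h₁, h₂] with u hu hu₁ hu₂
  exact ⟨hu, hu₁, hu₂⟩

lemma exists_ae_volume_jumpRegion_slice_le [Countable S] [IsStrictTotalOrder (Pairs S) r]
    (h : HasConstantSpacing lam lamT c) (ha₁ : 0 ≤ a₁) (ha₂ : 0 ≤ a₂) (i j : S) :
    ∃ M : ℝ≥0, ∀ᵐ u ∂halfLine, volume (Prod.mk u ⁻¹' jumpRegion r lam lamT i j a₁ a₂) ≤ M := by
  set M := ∑' p, ENNReal.ofReal (c p)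
  have hM : M ≠ ∞ := h.summable.tsum_ofReal_ne_top
  refine ⟨M.toNNReal + M.toNNReal, ?_⟩
  rw [halfLine_eq_restrict_Ioi]
  filter_upwards [h.ae_generic ha₁ ha₂] with u ⟨hu, hu₁, hu₂⟩
  rw [jumpRegion, preimage_union, prodMk_preimage_ageRegion hu, prodMk_preimage_ageRegion hu,
    ENNReal.coe_add, ENNReal.coe_toNNReal hM]
  exact (measure_union_le _ _).trans (add_le_add (volume_hitSet_le h.summable hu₁ i)
    (volume_hitSet_le h.summable hu₂ j))

lemma aedisjoint_ageRegion_hitSet [Countable S] [IsStrictTotalOrder (Pairs S) r]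
    (h : HasConstantSpacing lam lamT c) (ha₁ : 0 ≤ a₁) (ha₂ : 0 ≤ a₂) (hij : i ≠ j) :
    AEDisjoint (halfLine.prod volume) (ageRegion (hitSet r lam lamT i) a₁)
      (ageRegion (hitSet r lam lamT j) a₂) := by
  have hmeas (k : S) (a : ℝ) : MeasurableSet (ageRegion (hitSet r lam lamT k) a) :=
    measurableSet_ageRegion (measurableSet_mem_hitSet h.measurable_rate h.measurable_spacing k) a
  rw [AEDisjoint, Measure.measure_prod_null ((hmeas i a₁).inter (hmeas j a₂)),
    halfLine_eq_restrict_Ioi]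
  filter_upwards [h.ae_generic ha₁ ha₂] with u ⟨hu, hu₁, hu₂⟩
  rw [preimage_inter, prodMk_preimage_ageRegion hu, prodMk_preimage_ageRegion hu,
    (disjoint_hitSet hu₁ hu₂ hij).inter_eq, measure_empty, Pi.zero_apply]

lemma meeting_density_ae_eq [Countable S] [IsStrictTotalOrder (Pairs S) r]
    (h : HasConstantSpacing lam lamT c) (ha₁ : 0 ≤ a₁) (ha₂ : 0 ≤ a₂) (hij : i ≠ j) :
    (fun u => Real.exp (-∫ t in (0 : ℝ)..u,
        volume.real (Prod.mk t ⁻¹' jumpRegion r lam lamT i j a₁ a₂)) *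
      volume.real (Prod.mk u ⁻¹' meetingRegion r lam lamT hij a₁ a₂)) =ᵐ[volume.restrict (Ioi 0)]
    fun u => Real.exp (-∫ t in (0 : ℝ)..u, (exitRate lam i (a₁ + t) + exitRate lam j (a₂ + t))) *
      (lam ⟨(i, j), hij⟩ (a₁ + u) + lam ⟨(j, i), hij.symm⟩ (a₂ + u)) := by
  have h_generic := h.ae_generic ha₁ ha₂
  filter_upwards [h_generic] with u ⟨hu, hu₁, hu₂⟩
  have h_int : ∫ t in (0 : ℝ)..u, volume.real (Prod.mk t ⁻¹' jumpRegion r lam lamT i j a₁ a₂) =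
      ∫ t in (0 : ℝ)..u, (exitRate lam i (a₁ + t) + exitRate lam j (a₂ + t)) := by
    refine intervalIntegral.integral_congr_ae ?_
    filter_upwards [(ae_restrict_iff' measurableSet_Ioi).1 h_generic] with t ht ht_mem
    obtain ⟨ht₀, ht₁, ht₂⟩ := ht (uIoc_of_le hu.le ▸ ht_mem).1
    exact measureReal_jumpRegion_slice h.summable hij ht₀ ht₁ ht₂
  rw [h_int, measureReal_meetingRegion_slice h.summable hij hu hu₁ hu₂]

variable {Ω : Type*} [MeasurableSpace Ω] {P : Measure Ω} [IsProbabilityMeasure P]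
  {N : Ω → Measure (ℝ × ℝ)} {X₁ X₂ : ℝ → Ω → S} {Y₁ Y₂ : ℝ → Ω → ℝ}

lemma meetsAtNextTransition_ae_eq_firstPointIn [Countable S] [IsStrictTotalOrder (Pairs S) r]
    (h : HasConstantSpacing lam lamT c)
    (hN : IsPoissonRandomMeasure P N (halfLine.prod volume)) (hij : i ≠ j) (ha₁ : 0 ≤ a₁)
    (ha₂ : 0 ≤ a₂) (h₁ : IsSolution P r lam lamT N i a₁ X₁ Y₁)
    (h₂ : IsSolution P r lam lamT N j a₂ X₂ Y₂) :
    meetsAtNextTransition X₁ X₂ Y₁ Y₂ =ᵐ[P]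
      firstPointIn N (jumpRegion r lam lamT i j a₁ a₂) (meetingRegion r lam lamT hij a₁ a₂) := by
  have hmeas (k : S) (a : ℝ) : MeasurableSet (ageRegion (hitSet r lam lamT k) a) :=
    measurableSet_ageRegion (measurableSet_mem_hitSet h.measurable_rate h.measurable_spacing k) a
  have hU : MeasurableSet (jumpRegion r lam lamT i j a₁ a₂) :=
    measurableSet_jumpRegion h.measurable_rate h.measurable_spacing
  obtain ⟨M, hM⟩ := h.exists_ae_volume_jumpRegion_slice_le (r := r) ha₁ ha₂ i j
  have hU_rate := rateBounded_halfLine_prod hU jumpRegion_subset_Ioi hM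
  have hsimul := hN.ae_forall_slice_eq_zero_or_of_aedisjoint (hU_rate.mono subset_union_left)
    (hU_rate.mono subset_union_right) (hmeas i a₁) (hmeas j a₂)
    (h.aedisjoint_ageRegion_hitSet ha₁ ha₂ hij)
  refine eventuallyEq_set.2 ?_
  filter_upwards [hN.integer_valued, hN.ae_measure_Iic_ne_top hU_rate hU, hsimul, h₁, h₂]
    with ω hμ hfin hω hω₁ hω₂
  exact meets_iff_first_point_mem_meetingRegion h.measurable_rate h.measurable_spacing h.rate_le
    hμ hij hω₁ hω₂ ha₁ ha₂ hfin hω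

end HasConstantSpacing

end Intensity

end SemiMarkovFlow

end

open SemiMarkovFlow

theorem mainTheorem4_general {Ω : Type*} [MeasurableSpace Ω] (P : Measure Ω)
    [IsProbabilityMeasure P] (S : Set ℝ) (hS : S.Countable) (r : Pairs S → Pairs S → Prop)
    (hr : IsStrictTotalOrder (Pairs S) r) (lam lamT : Pairs S → ℝ → ℝ) (c : Pairs S → ℝ)
    (hlam : HasConstantSpacing lam lamT c) (N : Ω → Measure (ℝ × ℝ))
    (hN : IsPoissonRandomMeasure P N (halfLine.prod volume))
    (i j : S) (hij : i ≠ j) (y₁ y₂ : ℝ) (hy₁ : 0 ≤ y₁) (hy₂ : 0 ≤ y₂)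
    (X₁ X₂ : ℝ → Ω → S) (Y₁ Y₂ : ℝ → Ω → ℝ) (h₁ : IsSolution P r lam lamT N i y₁ X₁ Y₁)
    (h₂ : IsSolution P r lam lamT N j y₂ X₂ Y₂) :
    NullMeasurableSet (meetsAtNextTransition X₁ X₂ Y₁ Y₂) P ∧
    IntegrableOn
      (fun y : ℝ =>
        Real.exp (-∫ t in (0 : ℝ)..y, (exitRate lam i (y₁ + t) + exitRate lam j (y₂ + t))) *
        (lam ⟨(i, j), hij⟩ (y₁ + y) + lam ⟨(j, i), hij.symm⟩ (y₂ + y)))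
      (Ioi 0) ∧
    P.real (meetsAtNextTransition X₁ X₂ Y₁ Y₂) =
      ∫ y in Ioi (0 : ℝ),
        Real.exp (-∫ t in (0 : ℝ)..y, (exitRate lam i (y₁ + t) + exitRate lam j (y₂ + t))) *
        (lam ⟨(i, j), hij⟩ (y₁ + y) + lam ⟨(j, i), hij.symm⟩ (y₂ + y)) := by
  have : Countable S := hS.to_subtype
  obtain ⟨M, hM⟩ := hlam.exists_ae_volume_jumpRegion_slice_le (r := r) hy₁ hy₂ i j
  obtain ⟨h_null, h_int, h_prob⟩ := hN.measureReal_firstPointIn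
    (measurableSet_jumpRegion hlam.measurable_rate hlam.measurable_spacing)
    (measurableSet_meetingRegion hlam.measurable_rate hlam.measurable_spacing hij)
    (meetingRegion_subset_jumpRegion hij) jumpRegion_subset_Ioi hM
  have h_event := hlam.meetsAtNextTransition_ae_eq_firstPointIn hN hij hy₁ hy₂ h₁ h₂
  have h_density := hlam.meeting_density_ae_eq (r := r) hy₁ hy₂ hij
  exact ⟨h_null.congr h_event.symm, h_int.congr h_density,
    (measureReal_congr h_event).trans (h_prob.trans (integral_congr_ae h_density))⟩

theorem mainTheorem4 {Ω : Type*} [MeasurableSpace Ω] (P : MeasureTheory.Measure Ω)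
    [MeasureTheory.IsProbabilityMeasure P]
    (S : Set ℝ) (hS : S.Countable)
    (r : SemiMarkovFlow.Pairs S → SemiMarkovFlow.Pairs S → Prop)
    (hr : IsStrictTotalOrder (SemiMarkovFlow.Pairs S) r)
    (lam lamT : SemiMarkovFlow.Pairs S → ℝ → ℝ)
    (hlam : SemiMarkovFlow.IsRateMatrix lam)
    (hlamT : SemiMarkovFlow.IsSpacing lam lamT)
    (hA3 : SemiMarkovFlow.AssumptionA3 lam lamT)
    (N : Ω → MeasureTheory.Measure (ℝ × ℝ))
    (hN : SemiMarkovFlow.IsPoissonRandomMeasure P N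
      (SemiMarkovFlow.halfLine.prod MeasureTheory.volume))
    (i j : S) (hij : i ≠ j) (y₁ y₂ : ℝ) (hy₁ : 0 ≤ y₁) (hy₂ : 0 ≤ y₂)
    (X₁ X₂ : ℝ → Ω → S) (Y₁ Y₂ : ℝ → Ω → ℝ)
    (h₁ : SemiMarkovFlow.IsSolution P r lam lamT N i y₁ X₁ Y₁)
    (h₂ : SemiMarkovFlow.IsSolution P r lam lamT N j y₂ X₂ Y₂) :
    MeasureTheory.NullMeasurableSet
      (SemiMarkovFlow.meetsAtNextTransition X₁ X₂ Y₁ Y₂) P ∧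
    MeasureTheory.IntegrableOn
      (fun y : ℝ =>
        Real.exp (-∫ t in (0 : ℝ)..y,
          (SemiMarkovFlow.exitRate lam i (y₁ + t) + SemiMarkovFlow.exitRate lam j (y₂ + t))) *
        (lam ⟨(i, j), hij⟩ (y₁ + y) + lam ⟨(j, i), hij.symm⟩ (y₂ + y)))
      (Set.Ioi 0) ∧
    P.real (SemiMarkovFlow.meetsAtNextTransition X₁ X₂ Y₁ Y₂) =
      ∫ y in Set.Ioi (0 : ℝ),
        Real.exp (-∫ t in (0 : ℝ)..y,
          (SemiMarkovFlow.exitRate lam i (y₁ + t) + SemiMarkovFlow.exitRate lam j (y₂ + t))) *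
        (lam ⟨(i, j), hij⟩ (y₁ + y) + lam ⟨(j, i), hij.symm⟩ (y₂ + y)) :=
  mainTheorem4_general P S hS r hr lam lamT _ (hlam.hasConstantSpacing hlamT hA3) N hN i j hij y₁ y₂
    hy₁ hy₂ X₁ X₂ Y₁ Y₂ h₁ h₂
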